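/- A Buffon machine has a finite control with a designated start state, and a finite set of registers, initially empty. In each control state it either halts with an output bit in $\{0,1\}$ or executes one instruction, whose result selects the next control state. The instructions are: toss a fair coin; call the input, a generator of independent Bernoulli variables of parameter $x$ (unknown to the machine); or operate on a register. The registers are integer counters (add $1$, subtract $1$, test for $0$), stacks over $\{0,1\}$ (push, pop, recognizing the empty stack), string registers (a finite binary word with a cursor: rewind, advance, read, write or append at the cursor, erase from the cursor to the end), and bags. A bag holds the lazily generated binary digits $\upsilon_1,\upsilon_2,\dots$ of a number $U=\sum_{j\ge1}\upsilon_j2^{-j}$ uniform on $[0,1]$. A query of the bag tosses the fair coin until $1$ appears, say at toss number $J$, and returns $\upsilon_J$, which is first generated by one more toss of the fair coin if it has not been generated before. A bag can also be emptied, so that it starts afresh. A function $\phi:[0,1)\to[0,1]$ is strongly realizable by a machine $\mathcal M$ if, for every $x\in[0,1)$, $\mathcal M$ with an input generator of parameter $x$ halts with probability $1$, its output is $1$ with probability $\phi(x)$ and $0$ with probability $1-\phi(x)$, and the total number $C$ of coin tosses (fair coin, including those made by the bags, and calls of the input generator together) has exponential tails: there are $K$ and $\rho\in[0,1)$, which may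 depend on $x$, such that $\mathbb P(C>m)\le K\rho^m$ for all $m\ge0$. The machine $\mathcal M$ does not depend on $x$. Theorem. The following functions of $x$, $0\le x<1$, are strongly realizable: $$\log(1+x),\qquad \arctan x,\qquad \tfrac12\arcsin x,\qquad \int_0^x e^{-w^2/2}\,dw.$$ The first two are strongly realizable by machines whose only register is one bag, the third by a machine whose only registers are one bag and one stack, and the fourth by a machine whose only registers are one string register and one bag. -/

import Mathlib

noncomputable section

namespace Buffon

/-- The register set of a machine: how many integer counters, stacks, string registers
and (geometric) bags it owns. -/
structure Registers where
  numCounters : ℕ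
  numStacks : ℕ
  numStrings : ℕ
  numBags : ℕ

/-- A string register: a finite binary word `left ++ right` with a cursor that stands at the
beginning of `right`. The empty register is `⟨[], []⟩`. -/
structure StringReg where
  left : List Bool
  right : List Bool

namespace StringReg

/-- Bring the cursor back to the beginning of the word. -/
def rewind (w : StringReg) : StringReg := ⟨[], w.left ++ w.right⟩

/-- Move the cursor one letter to the right (no effect at the end of the word). -/
def advance (w : StringReg) : StringReg :=
  match w.right with
  | [] => w
  | a :: l => ⟨w.left ++ [a], l⟩

/-- The letter under the cursor, `none` at the end of the word. -/
def read (w : StringReg) : Option Bool := w.right.head?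

/-- Overwrite the letter under the cursor; at the end of the word, append a letter. -/
def write (w : StringReg) (a : Bool) : StringReg := ⟨w.left, a :: w.right.tail⟩

/-- Erase everything from the cursor to the end of the word. -/
def erase (w : StringReg) : StringReg := ⟨w.left, []⟩

end StringReg

/-- A geometric bag, the lazily generated binary expansion of one uniform `U ∈ [0,1]`:
`bits j` is the bit of weight `2 ^ (-(j + 1))` of `U`, or `none` as long as that bit has not
been generated; `ptr` is the index that is being drawn. -/
structure Bag where
  bits : ℕ → Option Bool
  ptr : ℕ

/-- The bag with no bit generated yet. -/
def Bag.empty : Bag := ⟨fun _ => none, 0⟩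

/-- The instructions of a machine with registers `R` and control states `Q`. Each names the
next control state, as a function of the result if it has one. -/
inductive Instr (R : Registers) (Q : Type) : Type
  /-- Halt with output `b`. -/
  | halt (b : Bool)
  /-- Toss the fair coin. -/
  | flip (q : Bool → Q)
  /-- Call the Bernoulli generator on the input. -/
  | input (q : Bool → Q)
  /-- Add one to a counter. -/
  | incr (c : Fin R.numCounters) (q : Q)
  /-- Subtract one from a counter. -/
  | decr (c : Fin R.numCounters) (q : Q)
  /-- Test whether a counter is zero. -/
  | isZero (c : Fin R.numCounters) (q : Bool → Q)
  /-- Push a letter on a stack. -/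
  | push (s : Fin R.numStacks) (a : Bool) (q : Q)
  /-- Pop the top of a stack; the result is `none` if the stack is empty. -/
  | pop (s : Fin R.numStacks) (q : Option Bool → Q)
  /-- Rewind a string register. -/
  | rewind (w : Fin R.numStrings) (q : Q)
  /-- Advance the cursor of a string register. -/
  | advance (w : Fin R.numStrings) (q : Q)
  /-- Read the letter under the cursor of a string register. -/
  | read (w : Fin R.numStrings) (q : Option Bool → Q)
  /-- Write a letter at the cursor of a string register. -/
  | write (w : Fin R.numStrings) (a : Bool) (q : Q)
  /-- Erase a string register from the cursor on. -/
  | erase (w : Fin R.numStrings) (q : Q)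
  /-- Empty a bag. -/
  | newBag (b : Fin R.numBags) (q : Q)
  /-- Query a bag: fetch its bit of index `J`, where `P(J = j) = 2 ^ (-(j + 1))`, `j ≥ 0`. -/
  | bag (b : Fin R.numBags) (q : Bool → Q)

/-- A machine with registers `R`: a finite set of control states, each with its instruction. -/
structure Machine (R : Registers) where
  State : Type
  finite : Finite State
  start : State
  code : State → Instr R State

variable {R : Registers}

/-- A configuration of the machine `M`: the control state, the contents of the registers, the
number `flips` of tosses of the fair coin and the number `calls` of calls of the input
generator that were made so far. -/
structure Config (M : Machine R) where
  state : M.State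
  counter : Fin R.numCounters → ℤ
  stack : Fin R.numStacks → List Bool
  str : Fin R.numStrings → StringReg
  bag : Fin R.numBags → Bag
  flips : ℕ
  calls : ℕ

/-- The initial configuration: all registers are empty. -/
def Config.init (M : Machine R) : Config M where
  state := M.start
  counter := fun _ => 0
  stack := fun _ => []
  str := fun _ => ⟨[], []⟩
  bag := fun _ => Bag.empty
  flips := 0
  calls := 0

/-- The output of a configuration: `some b` if the machine has halted with output `b`. -/
def Config.output {M : Machine R} (c : Config M) : Option Bool :=
  match M.code c.state with
  | .halt b => some b
  | _ => none

/-- The Bernoulli distribution on `{0, 1}` with `P(1) = p`. -/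
def ber (p : NNReal) (hp : p ≤ 1) : PMF Bool :=
  PMF.ofFintype (fun b => if b then (p : ENNReal) else 1 - (p : ENNReal)) (by
    simpa using add_tsub_cancel_of_le (ENNReal.coe_le_one_iff.2 hp))

/-- The fair coin. -/
def coin : PMF Bool := ber (1 / 2) (by norm_num)

/-- One step of the machine `M` on the input generator `X`, every coin toss being independent
of the past. A bag query takes several steps: the index is drawn first, in unary, by tossing
the fair coin until `1` shows up; then the bit of that index is generated by one more toss, if
it was not known before, and it is the result of the query. Every toss is counted. -/
def Machine.step (M : Machine R) (X : PMF Bool) (c : Config M) : PMF (Config M) :=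
  match M.code c.state with
  | .halt _ => PMF.pure c
  | .flip q => coin.map fun r => { c with state := q r, flips := c.flips + 1 }
  | .input q => X.map fun r => { c with state := q r, calls := c.calls + 1 }
  | .incr i q => PMF.pure
      { c with state := q, counter := Function.update c.counter i (c.counter i + 1) }
  | .decr i q => PMF.pure
      { c with state := q, counter := Function.update c.counter i (c.counter i - 1) }
  | .isZero i q => PMF.pure { c with state := q (decide (c.counter i = 0)) }
  | .push i a q => PMF.pure
      { c with state := q, stack := Function.update c.stack i (a :: c.stack i) }
  | .pop i q => PMF.pure
      { c with
        state := q (c.stack i).head?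
        stack := Function.update c.stack i (c.stack i).tail }
  | .rewind i q => PMF.pure
      { c with state := q, str := Function.update c.str i (c.str i).rewind }
  | .advance i q => PMF.pure
      { c with state := q, str := Function.update c.str i (c.str i).advance }
  | .read i q => PMF.pure { c with state := q (c.str i).read }
  | .write i a q => PMF.pure
      { c with state := q, str := Function.update c.str i ((c.str i).write a) }
  | .erase i q => PMF.pure
      { c with state := q, str := Function.update c.str i (c.str i).erase }
  | .newBag i q => PMF.pure
      { c with state := q, bag := Function.update c.bag i Bag.empty }
  | .bag i q =>
      coin.bind fun heads =>
        if heads then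
          match (c.bag i).bits (c.bag i).ptr with
          | some v => PMF.pure
              { c with
                state := q v
                bag := Function.update c.bag i ⟨(c.bag i).bits, 0⟩
                flips := c.flips + 1 }
          | none => coin.map fun v =>
              { c with
                state := q v
                bag := Function.update c.bag i
                  ⟨Function.update (c.bag i).bits (c.bag i).ptr (some v), 0⟩
                flips := c.flips + 2 }
        else PMF.pure
          { c with
            bag := Function.update c.bag i ⟨(c.bag i).bits, (c.bag i).ptr + 1⟩
            flips := c.flips + 1 }

/-- The law of the configuration of `M` after `n` steps, on the input generator `X`. -/
def Machine.run (M : Machine R) (X : PMF Bool) : ℕ → PMF (Config M)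
  | 0 => PMF.pure (Config.init M)
  | n + 1 => (M.run X n).bind (M.step X)

/-- On the input generator `X`, the machine `M` halts with output `b` with probability `p`
(the limit of the probability that it has done so after `n` steps). -/
def Machine.OutputsWithProb (M : Machine R) (X : PMF Bool) (b : Bool) (p : ℝ) : Prop :=
  Filter.Tendsto (fun n => ((M.run X n).toOuterMeasure {c | c.output = some b}).toReal)
    Filter.atTop (nhds p)

/-- On the input generator `X`, the total number `C` of coin tosses that `M` makes, fair flips
and calls of the input generator together, has exponential tails: `P(C > m) ≤ K ρ ^ m` with
`ρ < 1`. The event `C > m` is the increasing union over `n` of the events that more than `m`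
tosses are made in the first `n` steps. -/
def Machine.ExponentialTails (M : Machine R) (X : PMF Bool) : Prop :=
  ∃ K ρ : ℝ, 0 ≤ ρ ∧ ρ < 1 ∧ ∀ m n : ℕ,
    ((M.run X n).toOuterMeasure {c | m < c.flips + c.calls}).toReal ≤ K * ρ ^ m

/-- The function `φ` on `[0,1)` is strongly realizable by a machine with registers `R`: one
and the same machine, given a Bernoulli generator of any (unknown) parameter `x ∈ [0,1)`, halts
with probability one, its output is a Bernoulli variable of parameter `φ x`, and its number of
coin tosses has exponential tails. -/
def StronglyRealizable (R : Registers) (φ : ℝ → ℝ) : Prop :=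
  ∃ M : Machine R, ∀ (x : NNReal) (hx : x < 1),
    M.OutputsWithProb (ber x hx.le) true (φ x) ∧
    M.OutputsWithProb (ber x hx.le) false (1 - φ x) ∧
    M.ExponentialTails (ber x hx.le)

end Buffon

end

/-! Suppose all digits of the number `U` in the bag are known, `U = u`. A query draws the index `j`
with probability `2 ^ (-j)`, so it returns `1` with probability exactly `u`. For a known bag a
machine therefore tosses independent coins of parameters `1/2`, `x` and `u`. If it then outputs `1`
with probability `h u`, the true output probability is `∫ h` over the unit interval, and the task is
to produce the right integrand.

Alternating series come from parity: a trial of success probability `t`, repeated until it fails,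
has an even number of successes with probability `1 / (1 + t)`. After one successful call, `t = x u`
gives `x / (1 + x u)`, which integrates to `log (1 + x)`, and `t = (x u)²` gives `arctan x`. For the
arcsine, the input coin of the arctangent machine is replaced by a coin of parameter `y` with `x = 2
y / (1 + y²) = sin (2 arctan y)`: `y` is the probability that a killed simple random walk, kept on
the stack, descends one level. For the Gaussian, von Neumann's method is used: a trial of
probability `l = (x u)² / 2` must also draw a uniform number below its predecessor, so `n` successes
in a row have probability `l ^ n / n!`, and an even number of them in all has probability `exp
(-l)`.

Output probabilities are verified rather than computed from runs. A candidate satisfying the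
one-step equations (`Machine.IsValue`), averaged over the bits not generated yet (`annealedValue`),
is preserved in expectation by every step (`Machine.IsValue.expect_step`). Being bounded, and equal
to the output on halting, it gives the output probability as its initial value
(`Machine.Lyapunov.outputsWithProb`); `integral_binary` makes this value an integral over the unit
interval.

Almost sure halting and exponential tails both follow from a weight on control states that shrinks
in expectation by a fixed factor per step. `Machine.Ranked.exists_lyapunov` builds it from integer
ranks, using that every call of the input ends the run with probability `1 - x > 0`. -/

noncomputable section

namespace Buffon

open MeasureTheory

open scoped ENNReal

variable {R : Registers}

/-! ### Expectations under discrete laws -/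

/-- The expectation of a nonnegative function under a discrete law. -/
def expect {α : Type*} (p : PMF α) (f : α → ℝ≥0∞) : ℝ≥0∞ := ∑' a, p a * f a

section Expect

variable {α β : Type*}

@[simp] theorem expect_pure (a : α) (f : α → ℝ≥0∞) : expect (PMF.pure a) f = f a := by
  classical
  simp [expect, PMF.pure_apply]

@[simp] theorem expect_bind (p : PMF α) (k : α → PMF β) (f : β → ℝ≥0∞) :
    expect (p.bind k) f = expect p fun a => expect (k a) f := by
  simp only [expect, PMF.bind_apply, ← ENNReal.tsum_mul_right, ← ENNReal.tsum_mul_left]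
  rw [ENNReal.tsum_comm]
  simp only [mul_assoc]

@[simp] theorem expect_map (p : PMF α) (g : α → β) (f : β → ℝ≥0∞) :
    expect (p.map g) f = expect p fun a => f (g a) := by
  rw [PMF.map, expect_bind]
  simp

theorem expect_ber (x : NNReal) (hx : x ≤ 1) (f : Bool → ℝ≥0∞) :
    expect (ber x hx) f = x * f true + (1 - x) * f false := by
  rw [expect, tsum_bool, add_comm]
  simp [ber]

theorem expect_coin (f : Bool → ℝ≥0∞) : expect coin f = (f true + f false) / 2 := by
  rw [coin, expect_ber, ENNReal.div_eq_inv_mul, mul_add]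
  simp

theorem expect_mono {p : PMF α} {f g : α → ℝ≥0∞} (h : ∀ a ∈ p.support, f a ≤ g a) :
    expect p f ≤ expect p g := by
  refine ENNReal.tsum_le_tsum fun a => ?_
  by_cases ha : p a = 0
  · simp [ha]
  · gcongr
    exact h a ((PMF.mem_support_iff _ _).2 ha)

theorem expect_congr {p : PMF α} {f g : α → ℝ≥0∞} (h : ∀ a ∈ p.support, f a = g a) :
    expect p f = expect p g :=
  le_antisymm (expect_mono fun a ha => (h a ha).le) (expect_mono fun a ha => (h a ha).ge)

theorem expect_const_mul (p : PMF α) (c : ℝ≥0∞) (f : α → ℝ≥0∞) :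
    expect p (fun a => c * f a) = c * expect p f := by
  simp only [expect, ← ENNReal.tsum_mul_left]
  exact tsum_congr fun a => by ring

theorem expect_add (p : PMF α) (f g : α → ℝ≥0∞) :
    expect p (fun a => f a + g a) = expect p f + expect p g := by
  simp only [expect, mul_add, ENNReal.tsum_add]

theorem expect_one (p : PMF α) : expect p (fun _ => 1) = 1 := by
  simp [expect, p.tsum_coe]

theorem toOuterMeasure_eq_expect (p : PMF α) (s : Set α) :
    p.toOuterMeasure s = expect p (s.indicator fun _ => 1) := by
  rw [PMF.toOuterMeasure_apply]
  refine tsum_congr fun a => ?_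
  by_cases ha : a ∈ s <;> simp [ha]

theorem expect_coin_ofReal {f : Bool → ℝ} (h : ∀ b, 0 ≤ f b) :
    expect coin (fun b => ENNReal.ofReal (f b)) = ENNReal.ofReal ((f true + f false) / 2) := by
  rw [expect_coin, ENNReal.ofReal_div_of_pos two_pos, ENNReal.ofReal_add (h _) (h _)]
  simp

theorem expect_ber_ofReal (x : NNReal) (hx : x ≤ 1) {f : Bool → ℝ} (h : ∀ b, 0 ≤ f b) :
    expect (ber x hx) (fun b => ENNReal.ofReal (f b)) =
      ENNReal.ofReal (x * f true + (1 - x) * f false) := by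
  have hx' : (0 : ℝ) ≤ 1 - x := sub_nonneg.2 (by exact_mod_cast hx)
  rw [expect_ber, ENNReal.ofReal_add (mul_nonneg x.coe_nonneg (h _)) (mul_nonneg hx' (h _)),
    ENNReal.ofReal_mul x.coe_nonneg, ENNReal.ofReal_mul hx', ENNReal.ofReal_sub _ x.coe_nonneg]
  simp

end Expect

/-! ### Drift conditions: tails, halting and output probabilities -/

/-- A configuration has halted if it has an output. -/
def Config.Halted {M : Machine R} (c : Config M) : Prop := c.output.isSome

theorem Config.halted_iff {M : Machine R} {c : Config M} :
    c.Halted ↔ ∃ b, M.code c.state = .halt b := by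
  unfold Config.Halted Config.output
  cases M.code c.state <;> simp

theorem Machine.step_of_halted {M : Machine R} {X : PMF Bool} {c : Config M} (h : c.Halted) :
    M.step X c = PMF.pure c := by
  obtain ⟨b, hb⟩ := Config.halted_iff.1 h
  simp [Machine.step, hb]

theorem Machine.expect_run_succ (M : Machine R) (X : PMF Bool) (n : ℕ)
    (f : Config M → ℝ≥0∞) :
    expect (M.run X (n + 1)) f = expect (M.run X n) fun c => expect (M.step X c) f := by
  rw [Machine.run, expect_bind]

/-- The number of coin tosses made so far. -/
def Config.tosses {M : Machine R} (c : Config M) : ℕ := c.flips + c.calls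

/-- The two tosses occur in a bag query: the `1` that ends the draw of the index, and the toss that
generates a new bit. -/
theorem Machine.tosses_step_le {M : Machine R} {X : PMF Bool} {c c' : Config M}
    (h : c' ∈ (M.step X c).support) : c'.tosses ≤ c.tosses + 2 := by
  unfold Machine.step at h
  unfold Config.tosses
  cases hc : M.code c.state <;> simp only [hc] at h
  case bag i q =>
    rw [PMF.mem_support_bind_iff] at h
    obtain ⟨r, -, h⟩ := h
    cases r
    · simp only [Bool.false_eq_true, if_false, PMF.support_pure, Set.mem_singleton_iff] at h
      subst h; simp only; omega
    · simp only [if_true] at h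
      split at h
      · simp only [PMF.support_pure, Set.mem_singleton_iff] at h
        subst h; simp only; omega
      · rw [PMF.mem_support_map_iff] at h
        obtain ⟨r, -, rfl⟩ := h
        simp only; omega
  all_goals first
    | (rw [PMF.mem_support_map_iff] at h
       obtain ⟨r, -, rfl⟩ := h
       simp only; omega)
    | (simp only [PMF.support_pure, Set.mem_singleton_iff] at h
       subst h; try dsimp only
       omega)

/-- A weight on control states whose expectation shrinks by a factor `y` in each step before the
machine halts, when the input generator has parameter `x`. -/
def Machine.Lyapunov (M : Machine R) (x y : ℝ) (w : M.State → ℝ) : Prop :=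
  ∀ s, 1 ≤ w s ∧
    match M.code s with
    | .halt _ => True
    | .flip q => y * ((w (q true) + w (q false)) / 2) ≤ w s
    | .input q => y * (x * w (q true) + (1 - x) * w (q false)) ≤ w s
    | .isZero _ q => ∀ r, y * w (q r) ≤ w s
    | .pop _ q => ∀ r, y * w (q r) ≤ w s
    | .read _ q => ∀ r, y * w (q r) ≤ w s
    | .incr _ q => y * w q ≤ w s
    | .decr _ q => y * w q ≤ w s
    | .push _ _ q => y * w q ≤ w s
    | .rewind _ q => y * w q ≤ w s
    | .advance _ q => y * w q ≤ w s
    | .write _ _ q => y * w q ≤ w s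
    | .erase _ q => y * w q ≤ w s
    | .newBag _ q => y * w q ≤ w s
    | .bag _ q => ∀ r, y * ((w (q r) + w s) / 2) ≤ w s

/-- The weight of a configuration. -/
def Config.weight {M : Machine R} (w : M.State → ℝ) (c : Config M) : ℝ≥0∞ :=
  ENNReal.ofReal (w c.state)

theorem Machine.Lyapunov.expect_step_le {M : Machine R} {x : NNReal} (hx : x ≤ 1) {y : ℝ}
    (hy : 0 ≤ y) {w : M.State → ℝ} (hw : M.Lyapunov x y w) {c : Config M} (hc : ¬ c.Halted) :
    ENNReal.ofReal y * expect (M.step (ber x hx) c) (Config.weight w) ≤ c.weight w := by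
  have h0 : ∀ s, 0 ≤ w s := fun s => zero_le_one.trans (hw s).1
  have key := (hw c.state).2
  have coin_le : ∀ {f : Bool → ℝ} {a : ℝ}, (∀ b, 0 ≤ f b) → y * ((f true + f false) / 2) ≤ a →
      ENNReal.ofReal y * expect coin (fun b => ENNReal.ofReal (f b)) ≤ ENNReal.ofReal a := by
    intro f a hf h
    rw [expect_coin_ofReal hf, ← ENNReal.ofReal_mul hy]
    exact ENNReal.ofReal_le_ofReal h
  have pure_le : ∀ {a b : ℝ}, y * b ≤ a →
      ENNReal.ofReal y * ENNReal.ofReal b ≤ ENNReal.ofReal a := by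
    intro a b h
    rw [← ENNReal.ofReal_mul hy]
    exact ENNReal.ofReal_le_ofReal h
  unfold Machine.step
  cases hs : M.code c.state <;> simp only [hs] at key
  case halt b => exact absurd (Config.halted_iff.2 ⟨b, hs⟩) hc
  case flip q =>
    simp only [expect_map, Config.weight]
    exact coin_le (fun _ => h0 _) key
  case input q =>
    simp only [expect_map, Config.weight]
    rw [expect_ber_ofReal x hx (f := fun r => w (q r)) (fun _ => h0 _), ← ENNReal.ofReal_mul hy]
    exact ENNReal.ofReal_le_ofReal key
  case bag i q =>
    simp only [expect_bind]
    cases hb : (c.bag i).bits (c.bag i).ptr with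
    | some v =>
      have h := coin_le (f := fun r => if r then w (q v) else w c.state)
        (fun b => by cases b <;> simp [h0]) (by simpa using key v)
      refine le_trans (le_of_eq ?_) h
      congr 2
      funext r
      cases r <;> simp [Config.weight]
    -- The step averages over the new bit, so the average of the bounds for the two answers is
    -- enough.
    | none =>
      have h := coin_le (f := fun r => if r then (w (q true) + w (q false)) / 2 else w c.state)
        (fun b => by have := h0 (q true); have := h0 (q false); cases b <;> simp [h0]; positivity)
        (a := w c.state) (by
          have h1 := key true
          have h2 := key false
          simp only [if_true, Bool.false_eq_true, if_false]
          linarith)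
      refine le_trans (le_of_eq ?_) h
      congr 2
      funext r
      cases r
      · simp [Config.weight]
      · simp only [if_true, expect_map, Config.weight]
        exact expect_coin_ofReal (f := fun v => w (q v)) fun _ => h0 _
  all_goals
    simp only [expect_pure, Config.weight]
    first
      | exact pure_le key
      | exact pure_le (key _)

/-- `√y ^ tosses * weight` is a supermartingale: a step makes at most two tosses, which cost at most
the factor `y` gained by the weight. Since weights are at least `1`, Markov's inequality gives the
rate `1 / √y`. -/
theorem Machine.Lyapunov.exponentialTails {M : Machine R} {x : NNReal} (hx : x ≤ 1) {y : ℝ}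
    (hy : 1 < y) {w : M.State → ℝ} (hw : M.Lyapunov x y w) :
    M.ExponentialTails (ber x hx) := by
  have hz1 : 1 < √y := by rwa [Real.lt_sqrt zero_le_one, one_pow]
  set z := √y with hz
  have hz0 : 0 < z := by positivity
  have hzy : z ^ 2 = y := Real.sq_sqrt (by linarith)
  let Z := ENNReal.ofReal z
  have hZ1 : 1 ≤ Z := ENNReal.one_le_ofReal.2 hz1.le
  have hZt : Z ≠ ∞ := ENNReal.ofReal_ne_top
  have hZ0 : Z ≠ 0 := (zero_lt_one.trans_le hZ1).ne'
  have bound : ∀ n, expect (M.run (ber x hx) n) (fun c => Z ^ c.tosses * c.weight w) ≤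
      ENNReal.ofReal (w M.start) := by
    intro n
    induction n with
    | zero => simp [Machine.run, Config.tosses, Config.init, Config.weight]
    | succ n ih =>
      refine le_trans ?_ ih
      rw [Machine.expect_run_succ]
      refine expect_mono fun c _ => ?_
      by_cases hc : c.Halted
      · rw [Machine.step_of_halted hc, expect_pure]
      · calc expect (M.step (ber x hx) c) (fun c' => Z ^ c'.tosses * c'.weight w)
            ≤ expect (M.step (ber x hx) c) (fun c' => Z ^ (c.tosses + 2) * c'.weight w) :=
              expect_mono fun c' hc' => by
                exact mul_le_mul_left (pow_le_pow_right₀ hZ1 (Machine.tosses_step_le hc')) _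
          _ = Z ^ c.tosses *
              (ENNReal.ofReal y * expect (M.step (ber x hx) c) (Config.weight w)) := by
              rw [expect_const_mul, pow_add, ← hzy, ENNReal.ofReal_pow hz0.le, mul_assoc]
          _ ≤ _ := by
              gcongr
              exact hw.expect_step_le hx (by linarith) hc
  refine ⟨w M.start, z⁻¹, by positivity, inv_lt_one_of_one_lt₀ hz1, fun m n => ?_⟩
  have hw0 : 0 ≤ w M.start := zero_le_one.trans (hw _).1
  refine ENNReal.toReal_le_of_le_ofReal (by positivity) ?_
  rw [ENNReal.ofReal_mul hw0, inv_pow, ENNReal.ofReal_inv_of_pos (by positivity),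
    ENNReal.ofReal_pow hz0.le, ← div_eq_mul_inv,
    ENNReal.le_div_iff_mul_le (Or.inl (pow_ne_zero _ hZ0)) (Or.inl (ENNReal.pow_ne_top hZt)),
    toOuterMeasure_eq_expect, mul_comm, ← expect_const_mul]
  refine le_trans (expect_mono fun c _ => ?_) (bound n)
  by_cases hc : m < c.flips + c.calls
  · rw [Set.indicator_of_mem (by exact hc)]
    exact mul_le_mul' (pow_le_pow_right₀ hZ1 hc.le) (ENNReal.one_le_ofReal.2 (hw _).1)
  · rw [Set.indicator_of_notMem (by exact hc)]
    simp

/-- The weight restricted to running configurations has expectation at most `w M.start / y ^ n`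
after `n` steps, and it dominates their indicator. -/
theorem Machine.Lyapunov.tendsto_not_halted {M : Machine R} {x : NNReal} (hx : x ≤ 1) {y : ℝ}
    (hy : 1 < y) {w : M.State → ℝ} (hw : M.Lyapunov x y w) :
    Filter.Tendsto (fun n => (M.run (ber x hx) n).toOuterMeasure {c | ¬ c.Halted})
      Filter.atTop (nhds 0) := by
  classical
  let g : Config M → ℝ≥0∞ := fun c => if c.Halted then 0 else c.weight w
  have hY0 : ENNReal.ofReal y ≠ 0 := by simp; linarith
  have bound : ∀ n, expect (M.run (ber x hx) n) g ≤
      ENNReal.ofReal (w M.start) * (ENNReal.ofReal y)⁻¹ ^ n := by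
    intro n
    induction n with
    | zero =>
      simp only [Machine.run, expect_pure, g, pow_zero, mul_one]
      split_ifs
      · simp
      · exact le_rfl
    | succ n ih =>
      rw [Machine.expect_run_succ, pow_succ, ← mul_assoc, mul_comm _ (ENNReal.ofReal y)⁻¹]
      refine le_trans ?_ (mul_le_mul_right ih _)
      rw [← expect_const_mul]
      refine expect_mono fun c _ => ?_
      by_cases hc : c.Halted
      · simp [Machine.step_of_halted hc, g, hc]
      · have h := hw.expect_step_le hx (by linarith) hc
        simp only [g, hc, if_false]
        rw [mul_comm, ← div_eq_mul_inv, ENNReal.le_div_iff_mul_le (Or.inl hY0)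
          (Or.inl ENNReal.ofReal_ne_top), mul_comm]
        refine le_trans (mul_le_mul_right (expect_mono fun c' _ => ?_) _) h
        split_ifs
        · simp
        · exact le_rfl
  have lim : Filter.Tendsto (fun n => ENNReal.ofReal (w M.start) * (ENNReal.ofReal y)⁻¹ ^ n)
      Filter.atTop (nhds 0) := by
    have := ENNReal.Tendsto.const_mul (a := ENNReal.ofReal (w M.start))
      (ENNReal.tendsto_pow_atTop_nhds_zero_of_lt_one (r := (ENNReal.ofReal y)⁻¹)
        (ENNReal.inv_lt_one.2 (ENNReal.one_lt_ofReal.2 hy))) (Or.inr ENNReal.ofReal_ne_top)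
    simpa using this
  refine tendsto_of_tendsto_of_tendsto_of_le_of_le tendsto_const_nhds lim (fun _ => zero_le)
    fun n => le_trans ?_ (bound n)
  rw [toOuterMeasure_eq_expect]
  refine expect_mono fun c _ => ?_
  by_cases hc : c.Halted
  · simp [hc]
  · simp only [Set.indicator, Set.mem_ofPred_eq, hc, not_false_eq_true, if_true, g, if_false]
    exact ENNReal.one_le_ofReal.2 (hw _).1

/-- A function of the configuration that is preserved in expectation by every step from the
configurations of an invariant set, and that agrees with the output when the machine has halted,
has the probability of the output `true` as its initial value. -/
theorem Machine.Lyapunov.outputsWithProb {M : Machine R} {x : NNReal} (hx : x ≤ 1) {y : ℝ}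
    (hy : 1 < y) {w : M.State → ℝ} (hw : M.Lyapunov x y w) (I : Set (Config M))
    (hinit : Config.init M ∈ I)
    (hI : ∀ c ∈ I, ∀ c' ∈ (M.step (ber x hx) c).support, c' ∈ I)
    (f : Config M → ℝ≥0∞) (hf1 : ∀ c, f c ≤ 1)
    (hstep : ∀ c ∈ I, ¬ c.Halted → expect (M.step (ber x hx) c) f = f c)
    (htrue : ∀ c ∈ I, c.output = some true → f c = 1)
    (hfalse : ∀ c ∈ I, c.output = some false → f c = 0) :
    M.OutputsWithProb (ber x hx) true (f (Config.init M)).toReal ∧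
    M.OutputsWithProb (ber x hx) false (1 - (f (Config.init M)).toReal) := by
  have run_mem : ∀ n, ∀ c ∈ (M.run (ber x hx) n).support, c ∈ I := by
    intro n
    induction n with
    | zero => simp [Machine.run, hinit]
    | succ n ih =>
      intro c hc
      rw [Machine.run, PMF.mem_support_bind_iff] at hc
      obtain ⟨d, hd, hc⟩ := hc
      exact hI d (ih d hd) c hc
  have hconst : ∀ n, expect (M.run (ber x hx) n) f = f (Config.init M) := by
    intro n
    induction n with
    | zero => simp [Machine.run]
    | succ n ih =>
      rw [Machine.expect_run_succ, ← ih]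
      refine expect_congr fun c hc => ?_
      by_cases h : c.Halted
      · rw [Machine.step_of_halted h, expect_pure]
      · exact hstep c (run_mem n c hc) h
  -- With `T`, `F`, `N` the probabilities of output `true`, output `false` and still running, `f` is
  -- squeezed: `T n ≤ f (init) ≤ T n + N n`, with `N n → 0`.
  have hN := hw.tendsto_not_halted hx hy
  let T : ℕ → ℝ≥0∞ := fun n => (M.run (ber x hx) n).toOuterMeasure {c | c.output = some true}
  let F : ℕ → ℝ≥0∞ := fun n => (M.run (ber x hx) n).toOuterMeasure {c | c.output = some false}
  let N : ℕ → ℝ≥0∞ := fun n => (M.run (ber x hx) n).toOuterMeasure {c | ¬ c.Halted}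
  have hTle : ∀ n, T n ≤ f (Config.init M) := by
    intro n
    rw [← hconst n]
    simp only [T, toOuterMeasure_eq_expect]
    refine expect_mono fun c hc => ?_
    by_cases h : c.output = some true
    · simp [h, htrue c (run_mem n c hc) h]
    · simp [h]
  have hleT : ∀ n, f (Config.init M) ≤ T n + N n := by
    intro n
    rw [← hconst n]
    simp only [T, N, toOuterMeasure_eq_expect, ← expect_add]
    refine expect_mono fun c hc => ?_
    cases h : c.output with
    | none => simpa [h, Config.Halted] using hf1 c
    | some b =>
      cases b
      · simp [hfalse c (run_mem n c hc) h]
      · simpa [h] using (hf1 c).trans le_self_add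
  have hsum : ∀ n, T n + F n + N n = 1 := by
    intro n
    simp only [T, N, F, toOuterMeasure_eq_expect, ← expect_add]
    refine Eq.trans ?_ (expect_one (M.run (ber x hx) n))
    congr 1
    funext c
    cases h : c.output with
    | none => simp [h, Config.Halted]
    | some b => cases b <;> simp [h, Config.Halted]
  have hfin : f (Config.init M) ≠ ∞ := ((hf1 _).trans_lt ENNReal.one_lt_top).ne
  have hTfin : ∀ n, T n ≠ ∞ := fun n => ((hTle n).trans_lt hfin.lt_top).ne
  have hNfin : ∀ n, N n ≠ ∞ := fun n =>
    ((le_add_self.trans (hsum n).le).trans_lt ENNReal.one_lt_top).ne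
  have hFfin : ∀ n, F n ≠ ∞ := fun n =>
    (((le_add_self.trans le_self_add).trans (hsum n).le).trans_lt ENNReal.one_lt_top).ne
  have hNr : Filter.Tendsto (fun n => (N n).toReal) Filter.atTop (nhds 0) := by
    exact (ENNReal.tendsto_toReal ENNReal.zero_ne_top).comp hN
  have hT : Filter.Tendsto (fun n => (T n).toReal) Filter.atTop
      (nhds (f (Config.init M)).toReal) := by
    have lim : Filter.Tendsto (fun n => (f (Config.init M)).toReal - (N n).toReal) Filter.atTop
        (nhds (f (Config.init M)).toReal) := by
      simpa using tendsto_const_nhds.sub hNr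
    refine tendsto_of_tendsto_of_tendsto_of_le_of_le lim tendsto_const_nhds (fun n => ?_)
      fun n => ENNReal.toReal_mono hfin (hTle n)
    have := ENNReal.toReal_mono (ENNReal.add_ne_top.2 ⟨hTfin n, hNfin n⟩) (hleT n)
    rw [ENNReal.toReal_add (hTfin n) (hNfin n)] at this
    exact sub_le_iff_le_add.2 this
  refine ⟨hT, ?_⟩
  have hF : ∀ n, (F n).toReal = 1 - (T n).toReal - (N n).toReal := by
    intro n
    have := congrArg ENNReal.toReal (hsum n)
    rw [ENNReal.toReal_add (ENNReal.add_ne_top.2 ⟨hTfin n, hFfin n⟩) (hNfin n),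
      ENNReal.toReal_add (hTfin n) (hFfin n), ENNReal.toReal_one] at this
    linarith
  have lim := (tendsto_const_nhds (x := (1 : ℝ))).sub hT |>.sub hNr
  rw [sub_zero] at lim
  exact lim.congr fun n => (hF n).symm

/-! ### Fair bits and the uniform number -/

/-- The integral over the unit interval is the mean of its halves. -/
theorem integral_eq_mean_halves {g : ℝ → ℝ} (hg : ContinuousOn g (Set.Icc 0 1)) :
    ∫ t in (0 : ℝ)..1, g t =
      ((∫ t in (0 : ℝ)..1, g (t / 2)) + ∫ t in (0 : ℝ)..1, g ((1 + t) / 2)) / 2 := by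
  have h1 : ∫ t in (0 : ℝ)..1, g (t / 2) = 2 * ∫ t in (0 : ℝ)..(1 / 2), g t := by
    simp
  have h2 : ∫ t in (0 : ℝ)..1, g ((1 + t) / 2) = 2 * ∫ t in (1 / 2 : ℝ)..1, g t := by
    have h := intervalIntegral.integral_comp_add_div (a := 0) (b := 1) g (two_ne_zero' ℝ) (1 / 2)
    rw [smul_eq_mul, zero_div, add_zero, add_halves] at h
    rw [← h]
    simp only [add_div]
  have i1 : IntervalIntegrable g volume 0 (1 / 2) :=
    (hg.mono (by
      rw [Set.uIcc_of_le (by norm_num)]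
      exact Set.Icc_subset_Icc le_rfl (by norm_num))).intervalIntegrable
  have i2 : IntervalIntegrable g volume (1 / 2) 1 :=
    (hg.mono (by
      rw [Set.uIcc_of_le (by norm_num)]
      exact Set.Icc_subset_Icc (by norm_num) le_rfl)).intervalIntegrable
  rw [h1, h2, ← intervalIntegral.integral_add_adjacent_intervals i1 i2]
  ring

/-- A binary digit as a real number. -/
def digit (b : Bool) : ℝ := if b then 1 else 0

@[simp] theorem digit_true : digit true = 1 := rfl

@[simp] theorem digit_false : digit false = 0 := rfl

theorem digit_nonneg (b : Bool) : 0 ≤ digit b := by cases b <;> simp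

theorem digit_le_one (b : Bool) : digit b ≤ 1 := by cases b <;> simp

/-- The number with binary expansion `0.ω₀ω₁ω₂…`. -/
def binary (ω : ℕ → Bool) : ℝ := ∑' i, digit (ω i) * (1 / 2) ^ (i + 1)

theorem hasSum_half_pow_succ : HasSum (fun i : ℕ => (1 / 2 : ℝ) ^ (i + 1)) 1 := by
  have := hasSum_geometric_two.mul_right (1 / 2)
  norm_num at this
  simpa [pow_succ] using this

theorem summable_binary (ω : ℕ → Bool) :
    Summable fun i => digit (ω i) * (1 / 2 : ℝ) ^ (i + 1) :=
  hasSum_half_pow_succ.summable.of_nonneg_of_le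
    (fun i => mul_nonneg (digit_nonneg _) (by positivity))
    fun i => mul_le_of_le_one_left (by positivity) (digit_le_one _)

theorem binary_mem_Icc (ω : ℕ → Bool) : binary ω ∈ Set.Icc (0 : ℝ) 1 := by
  refine ⟨tsum_nonneg fun i => mul_nonneg (digit_nonneg _) (by positivity), ?_⟩
  rw [← hasSum_half_pow_succ.tsum_eq]
  exact (summable_binary ω).tsum_le_tsum
    (fun i => mul_le_of_le_one_left (by positivity) (digit_le_one _))
    hasSum_half_pow_succ.summable

theorem binary_eq (ω : ℕ → Bool) :
    binary ω = (digit (ω 0) + binary fun i => ω (i + 1)) / 2 := by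
  unfold binary
  rw [(summable_binary ω).tsum_eq_zero_add, add_div, ← tsum_div_const]
  congr 1
  · ring
  · exact tsum_congr fun i => by ring

theorem continuous_digit : Continuous digit := continuous_of_discreteTopology

theorem continuous_binary : Continuous binary := by
  refine continuous_tsum (fun i => ?_) hasSum_half_pow_succ.summable fun i ω => ?_
  · exact (continuous_digit.comp (continuous_apply i)).mul continuous_const
  · rw [Real.norm_of_nonneg (mul_nonneg (digit_nonneg _) (by positivity))]
    exact mul_le_of_le_one_left (by positivity) (digit_le_one _)

/-- The law of a sequence of independent fair bits. -/
def fairBits : Measure (ℕ → Bool) :=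
  Measure.infinitePi fun _ => (PMF.uniformOfFintype Bool).toMeasure

instance : IsProbabilityMeasure fairBits := by unfold fairBits; infer_instance

theorem map_not_uniform :
    (PMF.uniformOfFintype Bool).toMeasure.map not = (PMF.uniformOfFintype Bool).toMeasure := by
  rw [PMF.toMeasure_map (hf := measurable_of_finite _)]
  congr 1
  ext b
  rw [PMF.map_apply]
  cases b <;> simp

/-- Complementing a single coordinate preserves each factor of the product measure. -/
theorem integral_flip (j : ℕ) {G : (ℕ → Bool) → ℝ} (hG : Continuous G) :
    ∫ ω, G (Function.update ω j (!ω j)) ∂fairBits = ∫ ω, G ω ∂fairBits := by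
  let f : ℕ → Bool → Bool := fun i => if i = j then not else id
  have hf : (fun ω : ℕ → Bool => fun i => f i (ω i)) =
      fun ω => Function.update ω j (!ω j) := by
    funext ω i
    by_cases h : i = j
    · subst h; simp [f]
    · simp [f, h]
  have hm : ∀ i, Measurable (f i) := fun i => measurable_of_finite _
  have key : fairBits.map (fun ω => fun i => f i (ω i)) = fairBits := by
    unfold fairBits
    rw [Measure.infinitePi_map_pi _ hm]
    congr 1
    funext i
    by_cases h : i = j
    · simpa [f, h] using map_not_uniform
    · simp [f, h]
  have hmeas : Measurable fun ω : ℕ → Bool => fun i => f i (ω i) :=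
    measurable_pi_lambda _ fun i => (hm i).comp (measurable_pi_apply i)
  conv_rhs => rw [← key]
  rw [integral_map hmeas.aemeasurable hG.aestronglyMeasurable]
  exact integral_congr_ae (Filter.Eventually.of_forall fun ω => congrArg G (congrFun hf ω).symm)

theorem integrable_fairBits {G : (ℕ → Bool) → ℝ} (hG : Continuous G) :
    Integrable G fairBits :=
  hG.integrable_of_hasCompactSupport (HasCompactSupport.of_compactSpace G)

theorem continuous_update_const (j : ℕ) (v : Bool) :
    Continuous fun ω : ℕ → Bool => Function.update ω j v :=
  continuous_id.update j continuous_const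

/-- The analytic form of lazy generation: bit `j` may be replaced by a fresh fair toss. The sum of
the two updates is `G ω` plus `G` at `ω` with bit `j` flipped. -/
theorem integral_eq_mean_update (j : ℕ) {G : (ℕ → Bool) → ℝ} (hG : Continuous G) :
    ∫ ω, G ω ∂fairBits =
      ((∫ ω, G (Function.update ω j true) ∂fairBits) +
        ∫ ω, G (Function.update ω j false) ∂fairBits) / 2 := by
  have hc : ∀ v, Continuous fun ω : ℕ → Bool => G (Function.update ω j v) := fun v =>
    hG.comp (continuous_update_const j v)
  have hflip : Continuous fun ω : ℕ → Bool => G (Function.update ω j (!ω j)) :=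
    hG.comp (continuous_id.update j
      ((continuous_of_discreteTopology (f := not)).comp (continuous_apply j)))
  rw [← integral_add (integrable_fairBits (hc _)) (integrable_fairBits (hc _))]
  have : ∀ ω : ℕ → Bool, G (Function.update ω j true) + G (Function.update ω j false) =
      G ω + G (Function.update ω j (!ω j)) := by
    intro ω
    cases h : ω j
    · have : Function.update ω j false = ω := by rw [← h]; simp
      simp [this, add_comm]
    · have : Function.update ω j true = ω := by rw [← h]; simp
      simp [this]
  simp only [this]
  rw [integral_add (integrable_fairBits hG) (integrable_fairBits hflip), integral_flip j hG]
  ring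

/-- The left end of the dyadic interval of the numbers whose expansion begins with `s`. -/
def dyadic : List Bool → ℝ
  | [] => 0
  | v :: s => (digit v + dyadic s) / 2

theorem dyadic_append (s t : List Bool) :
    dyadic (s ++ t) = dyadic s + (1 / 2) ^ s.length * dyadic t := by
  induction s with
  | nil => simp [dyadic]
  | cons v s ih =>
    simp only [List.cons_append, dyadic, ih, List.length_cons, pow_succ]
    ring

theorem dyadic_singleton (v : Bool) : dyadic [v] = digit v / 2 := by simp [dyadic]

/-- The affine image of `[0,1]` on the dyadic interval of `s`. -/
def dyadicPoint (s : List Bool) (t : ℝ) : ℝ := dyadic s + (1 / 2) ^ s.length * t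

theorem dyadicPoint_cons (v : Bool) (s : List Bool) (t : ℝ) :
    dyadicPoint (v :: s) t = (digit v + dyadicPoint s t) / 2 := by
  simp only [dyadicPoint, dyadic, List.length_cons, pow_succ]
  ring

theorem dyadicPoint_append (s r : List Bool) (t : ℝ) :
    dyadicPoint (s ++ r) t = dyadicPoint s (dyadicPoint r t) := by
  simp only [dyadicPoint, dyadic_append, List.length_append, pow_add]
  ring

theorem dyadicPoint_nil (t : ℝ) : dyadicPoint [] t = t := by simp [dyadicPoint, dyadic]

theorem dyadicPoint_mem {s : List Bool} {t : ℝ} (ht : t ∈ Set.Icc (0 : ℝ) 1) :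
    dyadicPoint s t ∈ Set.Icc (0 : ℝ) 1 := by
  induction s with
  | nil => rwa [dyadicPoint_nil]
  | cons v s ih =>
    rw [dyadicPoint_cons]
    have h0 := digit_nonneg v
    have h1 := digit_le_one v
    exact ⟨by linarith [ih.1], by linarith [ih.2]⟩

theorem continuous_dyadicPoint (s : List Bool) : Continuous (dyadicPoint s) := by
  unfold dyadicPoint
  fun_prop

/-- The mean of a function over the dyadic interval of `s`. -/
def dyadicMean (h : ℝ → ℝ) (s : List Bool) : ℝ := ∫ t in (0 : ℝ)..1, h (dyadicPoint s t)

/-- The counterpart for Lebesgue measure of `integral_eq_mean_update`: the next digit halves the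
interval. -/
theorem dyadicMean_eq {h : ℝ → ℝ} (hh : ContinuousOn h (Set.Icc 0 1)) (s : List Bool) :
    dyadicMean h s = (dyadicMean h (s ++ [true]) + dyadicMean h (s ++ [false])) / 2 := by
  unfold dyadicMean
  rw [integral_eq_mean_halves (g := fun t => h (dyadicPoint s t))
    (hh.comp (continuous_dyadicPoint s).continuousOn fun t ht => dyadicPoint_mem ht), add_comm]
  simp only [dyadicPoint_append, dyadicPoint_cons, dyadicPoint_nil, digit_true, digit_false,
    zero_add]

/-- The sequence `ω` with its first terms replaced by `s`. -/
def overwrite : List Bool → (ℕ → Bool) → ℕ → Bool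
  | [], ω => ω
  | v :: s, ω => fun i => i.casesOn v fun i => overwrite s (fun k => ω (k + 1)) i

theorem overwrite_update (s : List Bool) (v : Bool) (ω : ℕ → Bool) :
    overwrite s (Function.update ω s.length v) = overwrite (s ++ [v]) ω := by
  induction s generalizing ω with
  | nil =>
    funext i
    cases i <;> simp [overwrite]
  | cons a s ih =>
    funext i
    cases i with
    | zero => rfl
    | succ i =>
      simp only [List.cons_append, overwrite, ← ih, List.length_cons]
      congr 1
      funext k
      simp [Function.update_apply]

theorem binary_overwrite (s : List Bool) (ω : ℕ → Bool) :
    ∃ t ∈ Set.Icc (0 : ℝ) 1, binary (overwrite s ω) = dyadicPoint s t := by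
  induction s generalizing ω with
  | nil => exact ⟨_, binary_mem_Icc ω, by rw [dyadicPoint_nil]; rfl⟩
  | cons v s ih =>
    obtain ⟨t, ht, h⟩ := ih fun k => ω (k + 1)
    refine ⟨t, ht, ?_⟩
    rw [binary_eq, dyadicPoint_cons, ← h]
    rfl

theorem continuous_overwrite (s : List Bool) : Continuous (overwrite s) := by
  induction s with
  | nil => exact continuous_id
  | cons v s ih =>
    refine continuous_pi fun i => ?_
    cases i with
    | zero => exact continuous_const
    | succ i =>
      exact (continuous_apply i).comp
        (ih.comp (continuous_pi fun k => continuous_apply (k + 1)))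

/-- The binary number with fair bits is uniform on the unit interval. -/
theorem integral_binary {h : ℝ → ℝ} (hh : ContinuousOn h (Set.Icc 0 1)) :
    ∫ ω, h (binary ω) ∂fairBits = ∫ t in (0 : ℝ)..1, h t := by
  have hcont : ∀ s, Continuous fun ω => h (binary (overwrite s ω)) := fun s =>
    hh.comp_continuous (continuous_binary.comp (continuous_overwrite s))
      fun ω => binary_mem_Icc _
  refine eq_of_forall_dist_le fun ε hε => ?_
  obtain ⟨δ, hδ, hu⟩ := Metric.uniformContinuousOn_iff_le.1
    (isCompact_Icc.uniformContinuousOn_of_continuous hh) ε hε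
  -- At depth `n` a dyadic interval is shorter than `δ`, so `h` varies there by at most `ε`.
  obtain ⟨n, hn⟩ := exists_pow_lt_of_lt_one hδ (show (1 / 2 : ℝ) < 1 by norm_num)
  -- Both means split in the same way under one more digit, so the error passes from depth `n` up to
  -- the root by averaging, without growing.
  have key : ∀ k, ∀ s : List Bool, s.length + k = n →
      |(∫ ω, h (binary (overwrite s ω)) ∂fairBits) - dyadicMean h s| ≤ ε := by
    intro k
    induction k with
    | zero =>
      intro s hs
      have close : ∀ ω, ∀ t ∈ Set.Icc (0 : ℝ) 1,
          |h (binary (overwrite s ω)) - h (dyadicPoint s t)| ≤ ε := by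
        intro ω t ht
        obtain ⟨t', ht', he⟩ := binary_overwrite s ω
        rw [he]
        refine hu _ (dyadicPoint_mem ht') _ (dyadicPoint_mem ht) ?_
        rw [Real.dist_eq, dyadicPoint, dyadicPoint, add_sub_add_left_eq_sub, ← mul_sub, abs_mul,
          abs_of_nonneg (by positivity)]
        refine le_trans (mul_le_of_le_one_right (by positivity) ?_) (by simpa [← hs] using hn.le)
        rw [abs_le]
        exact ⟨by linarith [ht.2, ht'.1], by linarith [ht.1, ht'.2]⟩
      have inner : ∀ ω, |h (binary (overwrite s ω)) - dyadicMean h s| ≤ ε := by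
        intro ω
        have hi : IntervalIntegrable (fun t => h (dyadicPoint s t)) volume 0 1 := by
          refine ContinuousOn.intervalIntegrable ?_
          rw [Set.uIcc_of_le zero_le_one]
          exact hh.comp (continuous_dyadicPoint s).continuousOn fun t ht => dyadicPoint_mem ht
        have hsub : h (binary (overwrite s ω)) - dyadicMean h s =
            ∫ t in (0 : ℝ)..1, (h (binary (overwrite s ω)) - h (dyadicPoint s t)) := by
          rw [intervalIntegral.integral_sub intervalIntegrable_const hi]
          simp [dyadicMean]
        rw [hsub]
        have := intervalIntegral.norm_integral_le_of_norm_le_const (a := 0) (b := 1) (C := ε)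
          (f := fun t => h (binary (overwrite s ω)) - h (dyadicPoint s t)) fun t ht => by
            rw [Set.uIoc_of_le zero_le_one] at ht
            exact close ω t ⟨ht.1.le, ht.2⟩
        simpa using this
      have hsub : (∫ ω, h (binary (overwrite s ω)) ∂fairBits) - dyadicMean h s =
          ∫ ω, (h (binary (overwrite s ω)) - dyadicMean h s) ∂fairBits := by
        rw [integral_sub (integrable_fairBits (hcont s)) (integrable_const _)]
        simp
      rw [hsub]
      have := norm_integral_le_of_norm_le_const (μ := fairBits) (C := ε)
        (f := fun ω => h (binary (overwrite s ω)) - dyadicMean h s)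
        (Filter.Eventually.of_forall inner)
      simpa using this
    | succ k ih =>
      intro s hs
      have h1 := ih (s ++ [true]) (by simp; omega)
      have h2 := ih (s ++ [false]) (by simp; omega)
      rw [integral_eq_mean_update s.length (hcont s), dyadicMean_eq hh]
      simp only [overwrite_update]
      rw [abs_le] at *
      constructor <;> linarith [h1.1, h1.2, h2.1, h2.2]
  simpa [Real.dist_eq, overwrite, dyadicMean, dyadicPoint_nil] using key n [] (by simp)

/-! ### Value functions: known bag and averaged bag -/

/-- The probability of the output `true` from a control state and given contents of the stacks
and strings, when the bag holds a known number `u` and the input generator has parameter `x`,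
for a machine that uses stacks, strings and the bag `i₀`, which it never empties: the function is
determined by one-step recurrences. -/
structure Machine.IsValue (M : Machine R) (i₀ : Fin R.numBags) (x : ℝ)
    (h : M.State → (Fin R.numStacks → List Bool) → (Fin R.numStrings → StringReg) → ℝ → ℝ) :
    Prop where
  mem : ∀ s σ τ, ∀ u ∈ Set.Icc (0 : ℝ) 1, h s σ τ u ∈ Set.Icc (0 : ℝ) 1
  cont : ∀ s σ τ, ContinuousOn (h s σ τ) (Set.Icc 0 1)
  step : ∀ s σ τ, ∀ u ∈ Set.Icc (0 : ℝ) 1,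
    match M.code s with
    | .halt b => h s σ τ u = digit b
    | .flip q => h s σ τ u = (h (q true) σ τ u + h (q false) σ τ u) / 2
    | .input q => h s σ τ u = x * h (q true) σ τ u + (1 - x) * h (q false) σ τ u
    | .push i a q => h s σ τ u = h q (Function.update σ i (a :: σ i)) τ u
    | .pop i q => h s σ τ u = h (q (σ i).head?) (Function.update σ i (σ i).tail) τ u
    | .rewind i q => h s σ τ u = h q σ (Function.update τ i (τ i).rewind) u
    | .advance i q => h s σ τ u = h q σ (Function.update τ i (τ i).advance) u
    | .read i q => h s σ τ u = h (q (τ i).read) σ τ u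
    | .write i a q => h s σ τ u = h q σ (Function.update τ i ((τ i).write a)) u
    | .erase i q => h s σ τ u = h q σ (Function.update τ i (τ i).erase) u
    | .bag i q => i = i₀ ∧ h s σ τ u = u * h (q true) σ τ u + (1 - u) * h (q false) σ τ u
    | .incr _ _ | .decr _ _ | .isZero _ _ | .newBag _ _ => False

/-- The bits of `ω`, with the known bits of a bag in place of those of the same index. -/
def fill (bits : ℕ → Option Bool) (ω : ℕ → Bool) : ℕ → Bool := fun i => (bits i).getD (ω i)

theorem continuous_fill (bits : ℕ → Option Bool) : Continuous (fill bits) := by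
  refine continuous_pi fun i => ?_
  unfold fill
  cases bits i with
  | none => exact continuous_apply i
  | some v => exact continuous_const

theorem fill_update {bits : ℕ → Option Bool} {j : ℕ} (hj : bits j = none) (v : Bool)
    (ω : ℕ → Bool) :
    fill bits (Function.update ω j v) = fill (Function.update bits j (some v)) ω := by
  funext i
  by_cases h : i = j
  · subst h; simp [fill, hj]
  · simp [fill, h]

theorem fill_update_self (bits : ℕ → Option Bool) (j : ℕ) (v : Bool) (ω : ℕ → Bool) :
    fill (Function.update bits j (some v)) ω j = v := by
  simp [fill]

/-- The binary number with bits `ω` from the index `j` on. -/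
def binaryTail (j : ℕ) (ω : ℕ → Bool) : ℝ := binary fun i => ω (i + j)

theorem binaryTail_zero (ω : ℕ → Bool) : binaryTail 0 ω = binary ω := rfl

/-- The geometric index in recursive form. `binaryTail j` is the chance that a query now at index
`j` answers `1`: on heads it returns bit `j`, on tails it moves to `j + 1`. -/
theorem binaryTail_eq (j : ℕ) (ω : ℕ → Bool) :
    binaryTail j ω = (digit (ω j) + binaryTail (j + 1) ω) / 2 := by
  unfold binaryTail
  rw [binary_eq, zero_add]
  congr 3
  funext i
  congr 1
  ring

theorem continuous_binaryTail (j : ℕ) : Continuous (binaryTail j) :=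
  continuous_binary.comp (continuous_pi fun i => continuous_apply (i + j))

theorem binaryTail_mem_Icc (j : ℕ) (ω : ℕ → Bool) : binaryTail j ω ∈ Set.Icc (0 : ℝ) 1 :=
  binary_mem_Icc _

theorem mix_mem {p a b : ℝ} (hp : p ∈ Set.Icc (0 : ℝ) 1) (ha : a ∈ Set.Icc (0 : ℝ) 1)
    (hb : b ∈ Set.Icc (0 : ℝ) 1) : p * a + (1 - p) * b ∈ Set.Icc (0 : ℝ) 1 :=
  (convex_Icc (0 : ℝ) 1) ha hb hp.1 (sub_nonneg.2 hp.2) (by ring)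

section Value

variable {M : Machine R} {i₀ : Fin R.numBags} {x : NNReal}
  {h : M.State → (Fin R.numStacks → List Bool) → (Fin R.numStrings → StringReg) → ℝ → ℝ}

/-- The value of a configuration when all the bits of the bag are known. If a query is under way,
the bag answers with the probability that is determined by the current index. -/
def quenchedValue (i₀ : Fin R.numBags)
    (h : M.State → (Fin R.numStacks → List Bool) → (Fin R.numStrings → StringReg) → ℝ → ℝ)
    (c : Config M) (ω : ℕ → Bool) : ℝ :=
  match M.code c.state with
  | .bag _ q =>
    binaryTail (c.bag i₀).ptr ω * h (q true) c.stack c.str (binary ω) +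
      (1 - binaryTail (c.bag i₀).ptr ω) * h (q false) c.stack c.str (binary ω)
  | _ => h c.state c.stack c.str (binary ω)

/-- The value of a configuration, averaged over the bits of the bag that are not known yet. -/
def annealedValue (i₀ : Fin R.numBags)
    (h : M.State → (Fin R.numStacks → List Bool) → (Fin R.numStrings → StringReg) → ℝ → ℝ)
    (c : Config M) : ℝ :=
  ∫ ω, quenchedValue i₀ h c (fill (c.bag i₀).bits ω) ∂fairBits

theorem Machine.IsValue.continuous_binary (hv : M.IsValue i₀ x h) (s σ τ) :
    Continuous fun ω => h s σ τ (binary ω) :=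
  (hv.cont s σ τ).comp_continuous Buffon.continuous_binary binary_mem_Icc

theorem Machine.IsValue.continuous_quenchedValue (hv : M.IsValue i₀ x h) (c : Config M) :
    Continuous (quenchedValue i₀ h c) := by
  unfold quenchedValue
  cases M.code c.state
  case bag i q =>
    have hp := continuous_binaryTail (c.bag i₀).ptr
    exact (hp.mul (hv.continuous_binary _ _ _)).add
      ((continuous_const.sub hp).mul (hv.continuous_binary _ _ _))
  all_goals exact hv.continuous_binary _ _ _

theorem Machine.IsValue.quenchedValue_mem (hv : M.IsValue i₀ x h) (c : Config M) (ω : ℕ → Bool) :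
    quenchedValue i₀ h c ω ∈ Set.Icc (0 : ℝ) 1 := by
  unfold quenchedValue
  cases M.code c.state
  case bag i q =>
    exact mix_mem (binaryTail_mem_Icc _ _) (hv.mem _ _ _ _ (binary_mem_Icc _))
      (hv.mem _ _ _ _ (binary_mem_Icc _))
  all_goals exact hv.mem _ _ _ _ (binary_mem_Icc _)

/-- A query that starts at index `0` answers `1` with probability the whole number, which is the bag
equation in `IsValue`. -/
theorem Machine.IsValue.quenchedValue_of_ptr_eq_zero (hv : M.IsValue i₀ x h) {c : Config M}
    (hc : (c.bag i₀).ptr = 0) (ω : ℕ → Bool) :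
    quenchedValue i₀ h c ω = h c.state c.stack c.str (binary ω) := by
  have := hv.step c.state c.stack c.str (binary ω) (binary_mem_Icc _)
  unfold quenchedValue
  cases hs : M.code c.state <;> simp only [hs] at this ⊢
  rw [this.2, hc, binaryTail_zero]

theorem Machine.IsValue.continuous_fill (hv : M.IsValue i₀ x h) (c : Config M) (bits) :
    Continuous fun ω => quenchedValue i₀ h c (fill bits ω) :=
  (hv.continuous_quenchedValue c).comp (Buffon.continuous_fill bits)

theorem Machine.IsValue.annealedValue_nonneg (hv : M.IsValue i₀ x h) (c : Config M) :
    0 ≤ annealedValue i₀ h c :=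
  integral_nonneg fun _ => (hv.quenchedValue_mem _ _).1

theorem Machine.IsValue.annealedValue_le_one (hv : M.IsValue i₀ x h) (c : Config M) :
    annealedValue i₀ h c ≤ 1 := by
  have := integral_mono (integrable_fairBits (hv.continuous_fill c (c.bag i₀).bits))
    (integrable_const (1 : ℝ)) fun _ => (hv.quenchedValue_mem _ _).2
  simpa [annealedValue] using this

/-- If the bag is not being queried, the value is an average of the values with a known bag. -/
theorem Machine.IsValue.annealedValue_of_ptr_eq_zero (hv : M.IsValue i₀ x h) {c : Config M}
    (hc : (c.bag i₀).ptr = 0) :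
    annealedValue i₀ h c =
      ∫ ω, h c.state c.stack c.str (binary (fill (c.bag i₀).bits ω)) ∂fairBits :=
  integral_congr_ae (Filter.Eventually.of_forall fun _ => hv.quenchedValue_of_ptr_eq_zero hc _)

theorem Machine.IsValue.integrable (hv : M.IsValue i₀ x h) (s σ τ bits) :
    Integrable (fun ω => h s σ τ (binary (fill bits ω))) fairBits :=
  integrable_fairBits ((hv.continuous_binary s σ τ).comp (Buffon.continuous_fill bits))

/-- The configurations in which a query of the bag can only be under way in a query state. -/
def idleOrQuery (M : Machine R) (i₀ : Fin R.numBags) : Set (Config M) :=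
  {c | (c.bag i₀).ptr = 0 ∨ ∃ i q, M.code c.state = .bag i q}

theorem Machine.IsValue.step_mem_idleOrQuery (hv : M.IsValue i₀ x h) {X : PMF Bool}
    {c c' : Config M} (hc : c ∈ idleOrQuery M i₀) (hc' : c' ∈ (M.step X c).support) :
    c' ∈ idleOrQuery M i₀ := by
  have key := hv.step c.state c.stack c.str 0 (by simp)
  change (c.bag i₀).ptr = 0 ∨ ∃ i q, M.code c.state = .bag i q at hc
  change (c'.bag i₀).ptr = 0 ∨ ∃ i q, M.code c'.state = .bag i q
  unfold Machine.step at hc'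
  cases hs : M.code c.state <;> simp only [hs] at key hc'
  case bag i q =>
    obtain ⟨rfl, -⟩ := key
    rw [PMF.mem_support_bind_iff] at hc'
    obtain ⟨r, -, hc'⟩ := hc'
    cases r
    · simp only [Bool.false_eq_true, if_false, PMF.support_pure, Set.mem_singleton_iff] at hc'
      subst hc'
      exact Or.inr ⟨i, q, hs⟩
    · simp only [if_true] at hc'
      left
      split at hc'
      · simp only [PMF.support_pure, Set.mem_singleton_iff] at hc'
        subst hc'; simp
      · rw [PMF.mem_support_map_iff] at hc'
        obtain ⟨r, -, rfl⟩ := hc'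
        simp
  all_goals
    left
    have h0 : (c.bag i₀).ptr = 0 := by simpa [hs] using hc
    first
      | (rw [PMF.mem_support_map_iff] at hc'
         obtain ⟨r, -, rfl⟩ := hc'
         exact h0)
      | (simp only [PMF.support_pure, Set.mem_singleton_iff] at hc'
         subst hc'
         exact h0)

/-- Heads replaces the value by `W`, the value after the answer `ω j`; tails only increments the
index. If bit `j` is unknown, its generating toss is absorbed by `integral_eq_mean_update`. -/
theorem Machine.IsValue.expect_query (hv : M.IsValue i₀ x h) {X : PMF Bool} {c : Config M}
    {q : Bool → M.State} (hs : M.code c.state = .bag i₀ q) :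
    expect (M.step X c) (fun c => ENNReal.ofReal (annealedValue i₀ h c)) =
      ENNReal.ofReal (annealedValue i₀ h c) := by
  set bits := (c.bag i₀).bits with hbits
  set j := (c.bag i₀).ptr with hj
  let W : (ℕ → Bool) → ℝ := fun ω => digit (ω j) * h (q true) c.stack c.str (binary ω) +
    (1 - digit (ω j)) * h (q false) c.stack c.str (binary ω)
  have hW : ∀ ω, W ω = h (q (ω j)) c.stack c.str (binary ω) := by
    intro ω
    cases h : ω j <;> simp [W, h]
  have hWc : Continuous W := by
    have hp := continuous_digit.comp (continuous_apply (A := fun _ : ℕ => Bool) j)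
    exact (hp.mul (hv.continuous_binary _ _ _)).add
      ((continuous_const.sub hp).mul (hv.continuous_binary _ _ _))
  have hWf : Continuous fun ω => W (fill bits ω) := hWc.comp (Buffon.continuous_fill bits)
  let tail : Config M := { c with
    bag := Function.update c.bag i₀ ⟨bits, j + 1⟩
    flips := c.flips + 1 }
  have htail_bits : (tail.bag i₀).bits = bits := by simp [tail]
  have hsplit : annealedValue i₀ h c =
      ((∫ ω, W (fill bits ω) ∂fairBits) + annealedValue i₀ h tail) / 2 := by
    unfold annealedValue
    rw [htail_bits, ← integral_add (integrable_fairBits hWf)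
      (integrable_fairBits (hv.continuous_fill tail bits)), ← integral_div]
    refine integral_congr_ae (Filter.Eventually.of_forall fun ω => ?_)
    have hs' : M.code tail.state = .bag i₀ q := hs
    have hp : (tail.bag i₀).ptr = j + 1 := by simp [tail]
    simp only [quenchedValue, hs, hs', hp]
    rw [← hj, binaryTail_eq j]
    simp only [W, tail]
    ring
  have hWpos : 0 ≤ ∫ ω, W (fill bits ω) ∂fairBits :=
    integral_nonneg fun ω => by
      change 0 ≤ W _
      rw [hW]
      exact (hv.mem _ _ _ _ (binary_mem_Icc _)).1
  rw [hsplit]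
  have hcoin := expect_coin_ofReal (f := fun r : Bool =>
    if r then ∫ ω, W (fill bits ω) ∂fairBits else annealedValue i₀ h tail)
    (fun b => by
      cases b
      · exact hv.annealedValue_nonneg _
      · exact hWpos)
  simp only [if_true, Bool.false_eq_true, if_false] at hcoin
  rw [← hcoin]
  unfold Machine.step
  simp only [hs, expect_bind]
  congr 1
  funext r
  cases r with
  | false => simp [tail, bits, j]
  | true =>
    simp only [if_true]
    rw [← hbits, ← hj]
    cases hb : bits j with
    | some v =>
      simp only [expect_pure]
      rw [hv.annealedValue_of_ptr_eq_zero (by simp)]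
      congr 1
      refine integral_congr_ae (Filter.Eventually.of_forall fun ω => ?_)
      simp only [Function.update_self, hW]
      simp [fill, hb]
    | none =>
      simp only [expect_map]
      rw [expect_coin_ofReal fun _ => hv.annealedValue_nonneg _,
        integral_eq_mean_update j hWf, hv.annealedValue_of_ptr_eq_zero (by simp),
        hv.annealedValue_of_ptr_eq_zero (by simp)]
      simp only [hW, Function.update_self, fill_update hb, fill_update_self]

/-- Outside query states the bag is untouched, so the pointwise equations of `IsValue` integrate
over the unknown bits. -/
theorem Machine.IsValue.expect_step (hx : x ≤ 1) (hv : M.IsValue i₀ x h) {c : Config M}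
    (hc : c ∈ idleOrQuery M i₀) :
    expect (M.step (ber x hx) c) (fun c => ENNReal.ofReal (annealedValue i₀ h c)) =
      ENNReal.ofReal (annealedValue i₀ h c) := by
  have key := fun u hu => hv.step c.state c.stack c.str u hu
  cases hs : M.code c.state
  case bag i q =>
    simp only [hs] at key
    obtain ⟨rfl, -⟩ := key 0 (by simp)
    exact hv.expect_query hs
  all_goals
    have h0 : (c.bag i₀).ptr = 0 := by
      change (c.bag i₀).ptr = 0 ∨ ∃ i q, M.code c.state = .bag i q at hc
      simpa [hs] using hc
    simp only [hs] at key
    unfold Machine.step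
    simp only [hs, expect_pure, expect_map]
  case flip q =>
    rw [expect_coin_ofReal fun _ => hv.annealedValue_nonneg _, hv.annealedValue_of_ptr_eq_zero h0,
      hv.annealedValue_of_ptr_eq_zero (by exact h0),
      hv.annealedValue_of_ptr_eq_zero (by exact h0),
      ← integral_add (hv.integrable _ _ _ _) (hv.integrable _ _ _ _), ← integral_div]
    congr 1
    exact integral_congr_ae (Filter.Eventually.of_forall fun ω => (key _ (binary_mem_Icc _)).symm)
  case input q =>
    rw [expect_ber_ofReal x hx (f := fun r => annealedValue i₀ h
        { c with state := q r, calls := c.calls + 1 }) fun _ => hv.annealedValue_nonneg _,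
      hv.annealedValue_of_ptr_eq_zero h0, hv.annealedValue_of_ptr_eq_zero (by exact h0),
      hv.annealedValue_of_ptr_eq_zero (by exact h0), ← integral_const_mul, ← integral_const_mul,
      ← integral_add ((hv.integrable _ _ _ _).const_mul _) ((hv.integrable _ _ _ _).const_mul _)]
    congr 1
    exact integral_congr_ae (Filter.Eventually.of_forall fun ω => (key _ (binary_mem_Icc _)).symm)
  case incr => exact (key 0 (by simp)).elim
  case decr => exact (key 0 (by simp)).elim
  case isZero => exact (key 0 (by simp)).elim
  case newBag => exact (key 0 (by simp)).elim
  all_goals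
    rw [hv.annealedValue_of_ptr_eq_zero h0, hv.annealedValue_of_ptr_eq_zero (by exact h0)]
    congr 1
    exact integral_congr_ae (Filter.Eventually.of_forall fun ω => (key _ (binary_mem_Icc _)).symm)

/-- The output of a machine with a bag is `true` with the probability that it has for a known
number in the bag, averaged over the unit interval. -/
theorem Machine.IsValue.outputsWithProb (hx : x ≤ 1) (hv : M.IsValue i₀ x h) {y : ℝ} (hy : 1 < y)
    {w : M.State → ℝ} (hw : M.Lyapunov x y w) {p : ℝ}
    (hp : ∫ u in (0 : ℝ)..1, h M.start (fun _ => []) (fun _ => ⟨[], []⟩) u = p) :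
    M.OutputsWithProb (ber x hx) true p ∧ M.OutputsWithProb (ber x hx) false (1 - p) := by
  have hout : ∀ c ∈ idleOrQuery M i₀, ∀ b, c.output = some b →
      annealedValue i₀ h c = digit b := by
    intro c hc b hb
    have hs : M.code c.state = .halt b := by
      unfold Config.output at hb
      cases hs : M.code c.state <;> simp_all
    have h0 : (c.bag i₀).ptr = 0 := by
      change (c.bag i₀).ptr = 0 ∨ ∃ i q, M.code c.state = .bag i q at hc
      simpa [hs] using hc
    have key := fun u hu => hv.step c.state c.stack c.str u hu
    simp only [hs] at key
    rw [hv.annealedValue_of_ptr_eq_zero h0]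
    simp [key _ (binary_mem_Icc _)]
  have main := hw.outputsWithProb hx hy (idleOrQuery M i₀) (Or.inl rfl)
    (fun c hc c' hc' => hv.step_mem_idleOrQuery hc hc')
    (fun c => ENNReal.ofReal (annealedValue i₀ h c))
    (fun c => ENNReal.ofReal_le_one.2 (hv.annealedValue_le_one c))
    (fun c hc _ => hv.expect_step hx hc)
    (fun c hc ho => by rw [hout c hc _ ho]; simp)
    (fun c hc ho => by rw [hout c hc _ ho]; simp)
  have hinit : annealedValue i₀ h (Config.init M) = p := by
    rw [hv.annealedValue_of_ptr_eq_zero rfl, ← hp, ← integral_binary (hv.cont _ _ _)]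
    rfl
  rwa [ENNReal.toReal_ofReal (hv.annealedValue_nonneg _), hinit] at main

end Value

/-- A function is strongly realizable if a machine has, for every parameter of the input, a
contracting weight and a value with known bag whose mean is the function. -/
theorem stronglyRealizable_of_isValue {φ : ℝ → ℝ} (M : Machine R) (i₀ : Fin R.numBags)
    (hM : ∀ x : NNReal, x < 1 →
      (∃ y > 1, ∃ w, M.Lyapunov x y w) ∧
      ∃ h, M.IsValue i₀ x h ∧
        ∫ u in (0 : ℝ)..1, h M.start (fun _ => []) (fun _ => ⟨[], []⟩) u = φ x) :
    StronglyRealizable R φ := by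
  refine ⟨M, fun x hx => ?_⟩
  obtain ⟨⟨y, hy, w, hw⟩, h, hv, hp⟩ := hM x hx
  obtain ⟨ht, hf⟩ := hv.outputsWithProb hx.le hy hw hp
  exact ⟨ht, hf, hw.exponentialTails hx.le hy⟩

/-! ### Contracting weights from ranks -/

/-- A state of rank `a` (a halting state if `a = none`) is at least `n` below the rank `k`. -/
def DropsBy (n : ℕ) (a : Option ℕ) (k : ℕ) : Prop := n ≤ k ∧ ∀ r ∈ a, r + n ≤ k

/-- A combinatorial condition on the control of a machine under which it halts fast: a failed call
of the input generator halts the machine, and between two calls the states descend in rank, except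
for one outcome of a coin toss at a time, which the other outcome makes up for. The rank of a
halting state is `none`. -/
def Machine.Ranked (M : Machine R) (d : M.State → Option ℕ) (K : ℕ) : Prop :=
  ∀ s, match d s with
    | none => ∃ b, M.code s = .halt b
    | some k => k ≤ K ∧
      match M.code s with
      | .halt _ => True
      | .flip q => (∀ r, DropsBy 1 (d (q r)) k) ∨
          ∃ b, (∀ r ∈ d (q b), r ≤ k + 4) ∧ DropsBy 11 (d (q !b)) k
      | .input q => d (q false) = none
      | .bag _ q => ∀ r, DropsBy 3 (d (q r)) k
      | .isZero _ q => ∀ r, DropsBy 1 (d (q r)) k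
      | .pop _ q => ∀ r, DropsBy 1 (d (q r)) k
      | .read _ q => ∀ r, DropsBy 1 (d (q r)) k
      | .incr _ q => DropsBy 1 (d q) k
      | .decr _ q => DropsBy 1 (d q) k
      | .push _ _ q => DropsBy 1 (d q) k
      | .rewind _ q => DropsBy 1 (d q) k
      | .advance _ q => DropsBy 1 (d q) k
      | .write _ _ q => DropsBy 1 (d q) k
      | .erase _ q => DropsBy 1 (d q) k
      | .newBag _ q => DropsBy 1 (d q) k

/-- The difference of the sides is `(t - 1) * (1 + t - t ^ 2)`. With `t = y` it says that a drop of
`3` pays for a bag query that stays put with probability `1/2`; with `t = y ^ 5`, that a drop of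
`11` pays for a rise of `4`. -/
theorem cube_add_one_le {t : ℝ} (h1 : 1 ≤ t) (h2 : t ≤ 3 / 2) : t ^ 3 + 1 ≤ 2 * t ^ 2 := by
  have h3 : 0 ≤ 1 + t - t ^ 2 := by nlinarith
  linarith [mul_nonneg (sub_nonneg.2 h1) h3,
    show (t - 1) * (1 + t - t ^ 2) = 2 * t ^ 2 - t ^ 3 - 1 by ring]

theorem exists_rate {x : ℝ} (hx0 : 0 ≤ x) (hx : x < 1) (K : ℕ) :
    ∃ y W : ℝ, 1 < y ∧ y ≤ 21 / 20 ∧ y ≤ W ∧ y * (x * (W * y ^ K) + (1 - x) * 1) ≤ W := by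
  have hcont : Filter.Tendsto (fun y : ℝ => x * y ^ (K + 1)) (nhdsWithin 1 (Set.Ioi 1))
      (nhds (x * 1 ^ (K + 1))) :=
    ((continuous_const.mul (continuous_pow _)).tendsto _).mono_left nhdsWithin_le_nhds
  rw [one_pow, mul_one] at hcont
  -- As `x < 1`, also `x * y ^ (K + 1) < 1` for `y` slightly above `1`.
  obtain ⟨y, hy, hy1, hy2⟩ := ((hcont.eventually_lt_const hx).and
    (Ioo_mem_nhdsGT (show (1 : ℝ) < 21 / 20 by norm_num))).exists
  have hpos : 0 < 1 - x * y ^ (K + 1) := sub_pos.2 hy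
  -- `W` solves `W = x * y ^ (K + 1) * W + y`; the required bound asks only for `y * (1 - x)` in
  -- place of the last `y`.
  refine ⟨y, y / (1 - x * y ^ (K + 1)), hy1, hy2.le, ?_, ?_⟩
  · rw [le_div_iff₀ hpos]
    have : 0 ≤ x * y ^ (K + 1) := by positivity
    nlinarith
  · have h : y / (1 - x * y ^ (K + 1)) * (1 - x * y ^ (K + 1)) = y :=
      div_mul_cancel₀ _ hpos.ne'
    set W := y / (1 - x * y ^ (K + 1))
    have h' : y * (x * (W * y ^ K) + (1 - x) * 1) = W - W * (1 - x * y ^ (K + 1)) + y - y * x := by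
      ring
    rw [h', h]
    nlinarith

/-- Rank `k` gets the weight `W * y ^ k` and halting states get `1`. A drop by `1` gains the factor
`y` of a step. A successful call may climb to any rank up to `K`, which `W` compensates through the
chance `1 - x` of halting. -/
theorem Machine.Ranked.exists_lyapunov {M : Machine R} {d : M.State → Option ℕ} {K : ℕ}
    (hd : M.Ranked d K) {x : NNReal} (hx : x < 1) :
    ∃ y > 1, ∃ w, M.Lyapunov x y w := by
  obtain ⟨y, W, hy1, hy2, hyW, hinput⟩ := exists_rate x.coe_nonneg (x := x) (by exact_mod_cast hx) K
  have hy0 : 0 < y := by linarith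
  have hW0 : 0 < W := by linarith
  let v : Option ℕ → ℝ := fun a => a.elim 1 fun k => W * y ^ k
  have hle : ∀ {a : Option ℕ} {k : ℕ}, (∀ r ∈ a, r ≤ k) → v a ≤ W * y ^ k := by
    rintro (_ | r) k h
    · have := one_le_pow₀ hy1.le (n := k)
      change 1 ≤ _
      nlinarith
    · have := pow_le_pow_right₀ hy1.le (h r rfl)
      exact mul_le_mul_of_nonneg_left this hW0.le
  have hdrop : ∀ {n : ℕ} {a : Option ℕ} {k : ℕ}, DropsBy n a k → y ^ n * v a ≤ W * y ^ k := by
    rintro n a k ⟨hn, h⟩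
    have := hle (a := a) (k := k - n) fun r hr => Nat.le_sub_of_add_le (h r hr)
    calc y ^ n * v a ≤ y ^ n * (W * y ^ (k - n)) :=
          mul_le_mul_of_nonneg_left this (pow_pos hy0 _).le
      _ = W * (y ^ n * y ^ (k - n)) := by ring
      _ = W * y ^ k := by rw [pow_mul_pow_sub _ hn]
  have hdrop1 : ∀ {a : Option ℕ} {k : ℕ}, DropsBy 1 a k → y * v a ≤ W * y ^ k := fun h => by
    simpa using hdrop h
  refine ⟨y, hy1, fun s => v (d s), fun s => ?_⟩
  have key := hd s
  cases hs : d s with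
  | none =>
    simp only [hs] at key
    obtain ⟨b, hb⟩ := key
    simp [v, hs, hb]
  | some k =>
    simp only [hs] at key
    obtain ⟨hk, key⟩ := key
    have hyk := one_le_pow₀ hy1.le (n := k)
    have hvs : v (d s) = W * y ^ k := by rw [hs]; rfl
    refine ⟨by simp only [hvs]; nlinarith, ?_⟩
    cases hc : M.code s <;> simp only [hc, hvs] at key ⊢
    case flip q =>
      rcases key with h | ⟨b, hup, hdown⟩
      · linarith [hdrop1 (h true), hdrop1 (h false)]
      · have hsum : v (d (q true)) + v (d (q false)) = v (d (q b)) + v (d (q !b)) := by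
          cases b
          · exact add_comm _ _
          · rfl
        rw [hsum]
        have h1 := hle hup
        have h2 := hdrop hdown
        have ht1 : 1 ≤ y ^ 5 := one_le_pow₀ hy1.le
        -- This is where the bound `21 / 20` on `y` is needed.
        have ht2 : y ^ 5 ≤ 3 / 2 :=
          (pow_le_pow_left₀ hy0.le hy2 5).trans (by norm_num)
        have hcubic : (y ^ 5) ^ 3 + 1 ≤ 2 * (y ^ 5) ^ 2 := cube_add_one_le ht1 ht2
        have hE : 0 < W * y ^ k := mul_pos hW0 (pow_pos hy0 _)
        have h3 : y ^ 11 * (y * ((v (d (q b)) + v (d (q !b))) / 2)) ≤ y ^ 11 * (W * y ^ k) :=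
          calc y ^ 11 * (y * ((v (d (q b)) + v (d (q !b))) / 2))
              = y / 2 * (y ^ 11 * v (d (q b)) + y ^ 11 * v (d (q !b))) := by ring
            _ ≤ y / 2 * (y ^ 11 * (W * y ^ (k + 4)) + W * y ^ k) := by gcongr
            _ = y / 2 * (W * y ^ k) * ((y ^ 5) ^ 3 + 1) := by ring
            _ ≤ y / 2 * (W * y ^ k) * (2 * (y ^ 5) ^ 2) := by gcongr
            _ = y ^ 11 * (W * y ^ k) := by ring
        exact le_of_mul_le_mul_left h3 (pow_pos hy0 _)
    case input q =>
      have h0 : v (d (q false)) = 1 := by rw [key]; rfl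
      have h1 : v (d (q true)) ≤ W * y ^ K := by
        refine hle fun r hr => ?_
        have := hd (q true)
        rw [Option.mem_def.1 hr] at this
        exact this.1
      rw [h0]
      calc y * (x * v (d (q true)) + (1 - x) * 1)
          ≤ y * (x * (W * y ^ K) + (1 - x) * 1) := by gcongr
        _ ≤ W := hinput
        _ ≤ W * y ^ k := le_mul_of_one_le_right hW0.le hyk
    case bag i q =>
      intro r
      have h := hdrop (key r)
      have hE : 0 < W * y ^ k := mul_pos hW0 (pow_pos hy0 _)
      have hq : 1 + y ^ 3 ≤ 2 * y ^ 2 := by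
        linarith [cube_add_one_le hy1.le (by linarith)]
      have h3 : y ^ 2 * (y * ((v (d (q r)) + W * y ^ k) / 2)) ≤ y ^ 2 * (W * y ^ k) :=
        calc y ^ 2 * (y * ((v (d (q r)) + W * y ^ k) / 2))
            = (y ^ 3 * v (d (q r)) + y ^ 3 * (W * y ^ k)) / 2 := by ring
          _ ≤ (W * y ^ k + y ^ 3 * (W * y ^ k)) / 2 := by gcongr
          _ = W * y ^ k * (1 + y ^ 3) / 2 := by ring
          _ ≤ W * y ^ k * (2 * y ^ 2) / 2 := by gcongr
          _ = y ^ 2 * (W * y ^ k) := by ring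
      exact le_of_mul_le_mul_left h3 (pow_pos hy0 _)
    all_goals first
      | exact hdrop1 key
      | exact fun r => hdrop1 (key r)

/-! ### Parity of a run of successes, and the logarithm -/

/-- The probability that a trial of success probability `t`, repeated until it fails, succeeds an
even number of times if `p` is true, and an odd number of times otherwise. -/
def evenOdd (p : Bool) (t : ℝ) : ℝ := if p then 1 / (1 + t) else t / (1 + t)

/-- Conditioning on the first trial: success switches the parity, failure ends the run with output
`p`. -/
theorem evenOdd_eq (p : Bool) {t : ℝ} (ht : 0 ≤ t) :
    evenOdd p t = t * evenOdd (!p) t + (1 - t) * digit p := by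
  have : 1 + t ≠ 0 := by positivity
  cases p <;> simp [evenOdd] <;> field_simp
  ring

theorem evenOdd_mem (p : Bool) {t : ℝ} (ht : 0 ≤ t) : evenOdd p t ∈ Set.Icc (0 : ℝ) 1 := by
  have : 0 < 1 + t := by positivity
  cases p
  · exact ⟨by simp [evenOdd]; positivity, by simp [evenOdd]; rw [div_le_one this]; linarith⟩
  · exact ⟨by simp [evenOdd]; positivity,
      by simp [evenOdd]; exact inv_le_one_of_one_le₀ (by linarith)⟩

theorem continuousOn_evenOdd {f : ℝ → ℝ} {s : Set ℝ} (hf : ContinuousOn f s)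
    (h0 : ∀ u ∈ s, 0 ≤ f u) (p : Bool) : ContinuousOn (fun u => evenOdd p (f u)) s := by
  have : ∀ u ∈ s, 1 + f u ≠ 0 := fun u hu => by have := h0 u hu; positivity
  cases p
  · exact hf.div (continuousOn_const.add hf) this
  · exact continuousOn_const.div (continuousOn_const.add hf) this

theorem digit_mem (b : Bool) : digit b ∈ Set.Icc (0 : ℝ) 1 := ⟨digit_nonneg b, digit_le_one b⟩

/-- The control states of a machine for the logarithm. -/
inductive LogState
  | start
  | call (p : Bool)
  | query (p : Bool)
  | halt (b : Bool)
  deriving Fintype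

/-- The registers consisting of one bag. -/
abbrev oneBag : Registers := ⟨0, 0, 0, 1⟩

/-- A machine that outputs `1` if a first call of the input generator succeeds and the number of
successes of a call together with a query of the bag, repeated until the first failure, is even. -/
def logMachine : Machine oneBag where
  State := LogState
  finite := inferInstance
  start := .start
  code
    | .start => .input fun r => if r then .call true else .halt false
    | .call p => .input fun r => if r then .query p else .halt p
    | .query p => .bag (0 : Fin 1) fun r => if r then .call (!p) else .halt p
    | .halt b => .halt b

theorem logMachine_ranked : logMachine.Ranked
    (fun | .start => some 0 | .call _ => some 0 | .query _ => some 3 | .halt _ => none) 3 := by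
  rintro (_ | p | p | b) <;> simp [logMachine, DropsBy]

/-- The value of the machine for the logarithm. -/
def logValue (x : ℝ) : LogState → ℝ → ℝ
  | .start, u => x * evenOdd true (x * u) + (1 - x) * 0
  | .call p, u => evenOdd p (x * u)
  | .query p, u => u * evenOdd (!p) (x * u) + (1 - u) * digit p
  | .halt b, _ => digit b

theorem logMachine_isValue {x : ℝ} (hx0 : 0 ≤ x) (hx1 : x ≤ 1) :
    logMachine.IsValue (0 : Fin 1) x fun s _ _ u => logValue x s u where
  mem := by
    have hx : x ∈ Set.Icc (0 : ℝ) 1 := ⟨hx0, hx1⟩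
    rintro (_ | p | p | b) - - u hu
    · exact mix_mem hx (evenOdd_mem _ (mul_nonneg hx0 hu.1)) (by simp)
    · exact evenOdd_mem _ (mul_nonneg hx0 hu.1)
    · exact mix_mem hu (evenOdd_mem _ (mul_nonneg hx0 hu.1)) (digit_mem _)
    · exact digit_mem _
  cont := by
    have hc : ∀ p, ContinuousOn (fun u => evenOdd p (x * u)) (Set.Icc 0 1) := fun p =>
      continuousOn_evenOdd (by fun_prop) (fun u hu => mul_nonneg hx0 hu.1) p
    rintro (_ | p | p | b) - -
    · exact (continuousOn_const.mul (hc _)).add continuousOn_const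
    · exact hc p
    · exact (continuousOn_id.mul (hc _)).add
        ((continuousOn_const.sub continuousOn_id).mul continuousOn_const)
    · exact continuousOn_const
  step := by
    rintro (_ | p | p | b) σ τ u hu
    · simp [logMachine, logValue]
    · simp only [logMachine, logValue, if_true, Bool.false_eq_true, if_false]
      rw [evenOdd_eq p (mul_nonneg hx0 hu.1)]
      ring
    · simp [logMachine, logValue]
    · rfl

/-- The start value `x / (1 + x * u)` is the derivative of `log (1 + x * u)` in `u`. -/
theorem integral_logValue {x : ℝ} (hx0 : 0 ≤ x) :
    ∫ u in (0 : ℝ)..1, logValue x .start u = Real.log (1 + x) := by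
  have hd : ∀ u ∈ Set.uIcc (0 : ℝ) 1,
      HasDerivAt (fun u => Real.log (1 + x * u)) (logValue x .start u) u := by
    intro u hu
    rw [Set.uIcc_of_le zero_le_one] at hu
    have hpos : 0 < 1 + x * u := by have := mul_nonneg hx0 hu.1; positivity
    have h := (((hasDerivAt_id u).const_mul x).const_add 1).log hpos.ne'
    exact h.congr_deriv (by simp [logValue, evenOdd, div_eq_mul_inv])
  have hc : ContinuousOn (logValue x .start) (Set.uIcc 0 1) := by
    rw [Set.uIcc_of_le zero_le_one]
    exact (continuousOn_const.mul (continuousOn_evenOdd (by fun_prop)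
      (fun u hu => mul_nonneg hx0 hu.1) true)).add continuousOn_const
  rw [intervalIntegral.integral_eq_sub_of_hasDerivAt hd hc.intervalIntegrable]
  simp

theorem stronglyRealizable_log : StronglyRealizable oneBag fun x => Real.log (1 + x) :=
  stronglyRealizable_of_isValue logMachine (0 : Fin 1) fun x hx =>
    ⟨logMachine_ranked.exists_lyapunov hx, _,
      logMachine_isValue x.coe_nonneg (by exact_mod_cast hx.le), integral_logValue x.coe_nonneg⟩

/-! ### The arctangent -/

/-- The control states of a machine for the arctangent. -/
inductive ArctanState
  | start
  | call (p : Bool)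
  | recall (p : Bool)
  | query (p : Bool)
  | requery (p : Bool)
  | halt (b : Bool)
  deriving Fintype

/-- A machine that outputs `1` if a first call of the input generator succeeds and the number of
successes of two calls together with two queries of the bag, repeated until the first failure, is
even. -/
def arctanMachine : Machine oneBag where
  State := ArctanState
  finite := inferInstance
  start := .start
  code
    | .start => .input fun r => if r then .call true else .halt false
    | .call p => .input fun r => if r then .recall p else .halt p
    | .recall p => .input fun r => if r then .query p else .halt p
    | .query p => .bag (0 : Fin 1) fun r => if r then .requery p else .halt p
    | .requery p => .bag (0 : Fin 1) fun r => if r then .call (!p) else .halt p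
    | .halt b => .halt b

theorem arctanMachine_ranked : arctanMachine.Ranked
    (fun | .start => some 0 | .call _ => some 0 | .recall _ => some 0 | .query _ => some 6
         | .requery _ => some 3 | .halt _ => none) 6 := by
  rintro (_ | p | p | p | p | b) <;> simp [arctanMachine, DropsBy]

/-- The value of the machine for the arctangent. -/
def arctanValue (x : ℝ) : ArctanState → ℝ → ℝ
  | .start, u => x * evenOdd true ((x * u) ^ 2) + (1 - x) * 0
  | .call p, u => evenOdd p ((x * u) ^ 2)
  | .recall p, u => x * (u * (u * evenOdd (!p) ((x * u) ^ 2) + (1 - u) * digit p) +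
      (1 - u) * digit p) + (1 - x) * digit p
  | .query p, u => u * (u * evenOdd (!p) ((x * u) ^ 2) + (1 - u) * digit p) + (1 - u) * digit p
  | .requery p, u => u * evenOdd (!p) ((x * u) ^ 2) + (1 - u) * digit p
  | .halt b, _ => digit b

theorem continuousOn_evenOdd_sq (a : ℝ) (p : Bool) :
    ContinuousOn (fun u => evenOdd p ((a * u) ^ 2)) (Set.Icc 0 1) :=
  continuousOn_evenOdd (by fun_prop) (fun u _ => sq_nonneg _) p

theorem arctanMachine_isValue {x : ℝ} (hx0 : 0 ≤ x) (hx1 : x ≤ 1) :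
    arctanMachine.IsValue (0 : Fin 1) x fun s _ _ u => arctanValue x s u where
  mem := by
    have hx : x ∈ Set.Icc (0 : ℝ) 1 := ⟨hx0, hx1⟩
    have hm := fun p (u : ℝ) => evenOdd_mem p (sq_nonneg (x * u))
    rintro (_ | p | p | p | p | b) - - u hu
    · exact mix_mem hx (hm _ _) (by simp)
    · exact hm _ _
    · exact mix_mem hx (mix_mem hu (mix_mem hu (hm _ _) (digit_mem _)) (digit_mem _)) (digit_mem _)
    · exact mix_mem hu (mix_mem hu (hm _ _) (digit_mem _)) (digit_mem _)
    · exact mix_mem hu (hm _ _) (digit_mem _)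
    · exact digit_mem _
  cont := by
    rintro (_ | p | p | p | p | b) - -
    all_goals
      have hc := continuousOn_evenOdd_sq x
      have h1 := hc true
      simp only [arctanValue]
      try have h2 := hc p
      try have h3 := hc !p
      fun_prop
  step := by
    rintro (_ | p | p | p | p | b) σ τ u hu
    · simp [arctanMachine, arctanValue]
    · simp only [arctanMachine, arctanValue, if_true, Bool.false_eq_true, if_false]
      rw [evenOdd_eq p (sq_nonneg _)]
      ring
    · simp [arctanMachine, arctanValue]
    · simp [arctanMachine, arctanValue]
    · simp [arctanMachine, arctanValue]
    · rfl

theorem integral_evenOdd_sq (a : ℝ) :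
    ∫ u in (0 : ℝ)..1, a * evenOdd true ((a * u) ^ 2) = Real.arctan a := by
  have hd : ∀ u ∈ Set.uIcc (0 : ℝ) 1,
      HasDerivAt (fun u => Real.arctan (a * u)) (a * evenOdd true ((a * u) ^ 2)) u := by
    intro u _
    have h := ((hasDerivAt_id u).const_mul a).arctan
    exact h.congr_deriv (by simp [evenOdd, mul_comm])
  have hc : ContinuousOn (fun u => a * evenOdd true ((a * u) ^ 2)) (Set.uIcc 0 1) := by
    rw [Set.uIcc_of_le zero_le_one]
    exact continuousOn_const.mul (continuousOn_evenOdd_sq a true)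
  rw [intervalIntegral.integral_eq_sub_of_hasDerivAt hd hc.intervalIntegrable]
  simp

theorem stronglyRealizable_arctan : StronglyRealizable oneBag fun x => Real.arctan x :=
  stronglyRealizable_of_isValue arctanMachine (0 : Fin 1) fun x hx =>
    ⟨arctanMachine_ranked.exists_lyapunov hx, _,
      arctanMachine_isValue x.coe_nonneg (by exact_mod_cast hx.le), by
        simpa [arctanMachine, arctanValue] using integral_evenOdd_sq x⟩

/-! ### The arcsine, by a killed random walk -/

/-- The probability that a simple random walk that is killed with probability `1 - x` before each
step ever reaches the level below its start. -/
def passageProb (x : ℝ) : ℝ := x / (1 + √(1 - x ^ 2))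

theorem passageProb_nonneg {x : ℝ} (hx0 : 0 ≤ x) : 0 ≤ passageProb x := by
  unfold passageProb
  positivity

theorem passageProb_le_one {x : ℝ} (hx1 : x ≤ 1) : passageProb x ≤ 1 := by
  unfold passageProb
  have := Real.sqrt_nonneg (1 - x ^ 2)
  rw [div_le_one (by positivity)]
  linarith

/-- First-step analysis: the walk survives with probability `x`, then descends at once or rises and
has two levels to descend. -/
theorem passageProb_eq {x : ℝ} (hx0 : 0 ≤ x) (hx1 : x ≤ 1) :
    2 * passageProb x = x * (1 + passageProb x ^ 2) := by
  have h0 := Real.sqrt_nonneg (1 - x ^ 2)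
  have h2 := Real.sq_sqrt (show 0 ≤ 1 - x ^ 2 by nlinarith)
  unfold passageProb
  set r := √(1 - x ^ 2)
  have : 1 + r ≠ 0 := by positivity
  field_simp
  linear_combination -x * h2

/-- The quadratic equation for `y` reads `x = 2 y / (1 + y²) = sin (2 arctan y)`, and `0 ≤ y ≤ 1`
keeps `2 arctan y` in the range of the arcsine. -/
theorem arctan_passageProb {x : ℝ} (hx0 : 0 ≤ x) (hx1 : x ≤ 1) :
    Real.arctan (passageProb x) = 1 / 2 * Real.arcsin x := by
  have hy0 := passageProb_nonneg hx0
  have hy1 := passageProb_le_one hx1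
  have hy := passageProb_eq hx0 hx1
  set y := passageProb x
  have hpos : 0 < 1 + y ^ 2 := by positivity
  have hsin : Real.sin (2 * Real.arctan y) = x := by
    rw [Real.sin_two_mul, Real.sin_arctan, Real.cos_arctan]
    have hs := Real.sq_sqrt hpos.le
    calc 2 * (y / √(1 + y ^ 2)) * (1 / √(1 + y ^ 2)) = 2 * y / √(1 + y ^ 2) ^ 2 := by
          field_simp
      _ = x := by rw [hs, hy, mul_div_assoc, div_self hpos.ne', mul_one]
  have h0 : 0 ≤ Real.arctan y := Real.arctan_nonneg.2 hy0
  have h1 : Real.arctan y ≤ Real.pi / 4 := by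
    rw [← Real.arctan_one]
    exact Real.arctan_strictMono.monotone hy1
  have hpi := Real.pi_pos
  rw [← hsin, Real.arcsin_sin (by linarith) (by linarith)]
  ring

/-- The stages of the machine for the arcsine at which it runs a random walk. -/
inductive WalkStage
  | start
  | first (p : Bool)
  | second (p : Bool)
  deriving Fintype

/-- The control states of a machine for the arcsine. -/
inductive ArcsinState
  | call (k : WalkStage)
  | toss (k : WalkStage)
  | up (k : WalkStage)
  | down (k : WalkStage)
  | query (p : Bool)
  | requery (p : Bool)
  | halt (b : Bool)
  deriving Fintype

/-- The output of the machine if the walk of a stage is killed. -/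
def WalkStage.killed : WalkStage → Bool
  | .start => false
  | .first p => p
  | .second p => p

/-- The control state after the walk of a stage has reached its goal. -/
def WalkStage.next : WalkStage → ArcsinState
  | .start => .call (.first true)
  | .first p => .call (.second p)
  | .second p => .query p

/-- The registers consisting of one stack and one bag. -/
abbrev stackAndBag : Registers := ⟨0, 1, 0, 1⟩

/-- The machine for the arctangent, with each call of the input generator replaced by a random
walk whose height is that of the stack: it is killed if a call of the input generator before one
of its steps fails, and it reaches its goal when the empty stack is popped. -/
def arcsinMachine : Machine stackAndBag where
  State := ArcsinState
  finite := inferInstance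
  start := .call .start
  code
    | .call k => .input fun r => if r then .toss k else .halt k.killed
    | .toss k => .flip fun r => if r then .up k else .down k
    | .up k => .push (0 : Fin 1) true (.call k)
    | .down k => .pop (0 : Fin 1) fun r => if r.isSome then .call k else k.next
    | .query p => .bag (0 : Fin 1) fun r => if r then .requery p else .halt p
    | .requery p => .bag (0 : Fin 1) fun r => if r then .call (.first !p) else .halt p
    | .halt b => .halt b

/-- The walk needs no drift: each of its steps is preceded by a call that may kill it. The ranks
only order the states between two calls. -/
theorem arcsinMachine_ranked : arcsinMachine.Ranked
    (fun | .call _ => some 0 | .toss _ => some 8 | .up _ => some 7 | .down _ => some 7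
         | .query _ => some 6 | .requery _ => some 3 | .halt _ => none) 8 := by
  rintro (k | k | k | k | p | p | b)
  case down =>
    refine ⟨by norm_num, ?_⟩
    rintro (_ | r)
    · cases k <;> simp [DropsBy, WalkStage.next]
    · simp [DropsBy]
  all_goals simp [arcsinMachine, DropsBy]

/-- The probability of the output `true` after the walk of a stage has reached its goal, if the
bag holds `u` and walks reach their goals with probability `y`. -/
def WalkStage.nextValue (y u : ℝ) : WalkStage → ℝ
  | .start => evenOdd true ((y * u) ^ 2)
  | .first p => y * (u * (u * evenOdd (!p) ((y * u) ^ 2) + (1 - u) * digit p) +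
      (1 - u) * digit p) + (1 - y) * digit p
  | .second p => u * (u * evenOdd (!p) ((y * u) ^ 2) + (1 - u) * digit p) + (1 - u) * digit p

/-- The probability of the output `true` if the walk of a stage has `n` levels to descend. -/
def WalkStage.value (y : ℝ) (n : ℕ) (k : WalkStage) (u : ℝ) : ℝ :=
  y ^ n * k.nextValue y u + (1 - y ^ n) * digit k.killed

theorem WalkStage.nextValue_mem {y u : ℝ} (hy : y ∈ Set.Icc (0 : ℝ) 1)
    (hu : u ∈ Set.Icc (0 : ℝ) 1) (k : WalkStage) : k.nextValue y u ∈ Set.Icc (0 : ℝ) 1 := by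
  have hm := fun p => evenOdd_mem p (sq_nonneg (y * u))
  rcases k with _ | p | p
  · exact hm _
  · exact mix_mem hy (mix_mem hu (mix_mem hu (hm _) (digit_mem _)) (digit_mem _)) (digit_mem _)
  · exact mix_mem hu (mix_mem hu (hm _) (digit_mem _)) (digit_mem _)

theorem WalkStage.value_mem {y u : ℝ} (hy : y ∈ Set.Icc (0 : ℝ) 1)
    (hu : u ∈ Set.Icc (0 : ℝ) 1) (n : ℕ) (k : WalkStage) :
    k.value y n u ∈ Set.Icc (0 : ℝ) 1 :=
  mix_mem ⟨pow_nonneg hy.1 _, pow_le_one₀ hy.1 hy.2⟩ (k.nextValue_mem hy hu) (digit_mem _)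

theorem WalkStage.continuousOn_value (y : ℝ) (n : ℕ) (k : WalkStage) :
    ContinuousOn (k.value y n) (Set.Icc 0 1) := by
  have : ContinuousOn (fun u => k.nextValue y u) (Set.Icc 0 1) := by
    have hc := continuousOn_evenOdd_sq y
    rcases k with _ | p | p
    · exact hc true
    · have := hc !p
      simp only [WalkStage.nextValue]
      fun_prop
    · have := hc !p
      simp only [WalkStage.nextValue]
      fun_prop
  exact (continuousOn_const.mul this).add continuousOn_const

/-- Multiplying the equation of `passageProb` by `y ^ n` shows that the powers of `y` solve the
recurrence of the killed walk. -/
theorem WalkStage.value_eq {x y : ℝ} (h : 2 * y = x * (1 + y ^ 2)) (n : ℕ) (k : WalkStage)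
    (u : ℝ) : k.value y (n + 1) u =
      x * ((k.value y (n + 2) u + k.value y n u) / 2) + (1 - x) * digit k.killed := by
  unfold WalkStage.value
  linear_combination (y ^ n * (k.nextValue y u - digit k.killed) / 2) * h

/-- The value of the machine for the arcsine when the stack has height `n`. -/
def arcsinValue (y : ℝ) (n : ℕ) : ArcsinState → ℝ → ℝ
  | .call k, u => k.value y (n + 1) u
  | .toss k, u => (k.value y (n + 2) u + k.value y n u) / 2
  | .up k, u => k.value y (n + 2) u
  | .down k, u => k.value y n u
  | .query p, u => u * (u * (WalkStage.first !p).value y (n + 1) u + (1 - u) * digit p) +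
      (1 - u) * digit p
  | .requery p, u => u * (WalkStage.first !p).value y (n + 1) u + (1 - u) * digit p
  | .halt b, _ => digit b

theorem WalkStage.value_first (y u : ℝ) (p : Bool) :
    (WalkStage.first p).value y 1 u = evenOdd p ((y * u) ^ 2) := by
  rw [evenOdd_eq p (sq_nonneg _)]
  simp only [WalkStage.value, WalkStage.nextValue, WalkStage.killed]
  ring

/-- A stage ends with the empty stack, so the next walk again starts one level above its goal. -/
theorem arcsinValue_next (y u : ℝ) (k : WalkStage) :
    arcsinValue y 0 k.next u = k.value y 0 u := by
  rcases k with _ | p | p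
  · simp only [WalkStage.next, arcsinValue, zero_add, WalkStage.value_first]
    simp [WalkStage.value, WalkStage.nextValue]
  · simp [WalkStage.next, arcsinValue, WalkStage.value, WalkStage.nextValue, WalkStage.killed]
  · simp only [WalkStage.next, arcsinValue, zero_add, WalkStage.value_first]
    simp [WalkStage.value, WalkStage.nextValue]

theorem arcsinMachine_isValue {x : ℝ} (hx0 : 0 ≤ x) (hx1 : x ≤ 1) :
    arcsinMachine.IsValue (0 : Fin 1) x
      fun s σ _ u => arcsinValue (passageProb x) (σ (0 : Fin 1)).length s u where
  mem := by
    have hy : passageProb x ∈ Set.Icc (0 : ℝ) 1 :=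
      ⟨passageProb_nonneg hx0, passageProb_le_one hx1⟩
    rintro (k | k | k | k | p | p | b) σ - u hu
    · exact k.value_mem hy hu _
    · have h1 := k.value_mem hy hu ((σ (0 : Fin 1)).length + 2)
      have h2 := k.value_mem hy hu (σ (0 : Fin 1)).length
      simp only [arcsinValue]
      exact ⟨by linarith [h1.1, h2.1], by linarith [h1.2, h2.2]⟩
    · exact k.value_mem hy hu _
    · exact k.value_mem hy hu _
    · exact mix_mem hu (mix_mem hu (WalkStage.value_mem hy hu _ _) (digit_mem _)) (digit_mem _)
    · exact mix_mem hu (WalkStage.value_mem hy hu _ _) (digit_mem _)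
    · exact digit_mem _
  cont := by
    have hc := fun n k => WalkStage.continuousOn_value (passageProb x) n k
    rintro (k | k | k | k | p | p | b) σ -
    · exact hc _ k
    · exact ((hc _ k).add (hc _ k)).div_const 2
    · exact hc _ k
    · exact hc _ k
    · have := hc ((σ (0 : Fin 1)).length + 1) (.first !p)
      simp only [arcsinValue]
      fun_prop
    · have := hc ((σ (0 : Fin 1)).length + 1) (.first !p)
      simp only [arcsinValue]
      fun_prop
    · exact continuousOn_const
  step := by
    rintro (k | k | k | k | p | p | b) σ τ u hu
    · simpa [arcsinMachine, arcsinValue] using k.value_eq (passageProb_eq hx0 hx1) _ u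
    · simp [arcsinMachine, arcsinValue]
    · simp [arcsinMachine, arcsinValue]
    · simp only [arcsinMachine, Function.update_self]
      cases hσ : σ (0 : Fin 1) with
      | nil => simpa [arcsinValue] using (arcsinValue_next (passageProb x) u k).symm
      | cons a l => simp [arcsinValue]
    · simp [arcsinMachine, arcsinValue]
    · simp [arcsinMachine, arcsinValue]
    · rfl

theorem stronglyRealizable_half_arcsin :
    StronglyRealizable stackAndBag fun x => 1 / 2 * Real.arcsin x :=
  stronglyRealizable_of_isValue arcsinMachine (0 : Fin 1) fun x hx => by
    have hx1 : (x : ℝ) ≤ 1 := by exact_mod_cast hx.le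
    refine ⟨arcsinMachine_ranked.exists_lyapunov hx, _,
      arcsinMachine_isValue x.coe_nonneg hx1, ?_⟩
    rw [← arctan_passageProb x.coe_nonneg hx1, ← integral_evenOdd_sq]
    simp [arcsinMachine, arcsinValue, WalkStage.value, WalkStage.nextValue, WalkStage.killed]

/-! ### Exponential means over dyadic intervals and the comparison of numbers -/

/-- The integral of `exp (-(l * w))` over `[0, v]`. -/
def expIntegral (l v : ℝ) : ℝ := ∫ w in (0 : ℝ)..v, Real.exp (-(l * w))

theorem intervalIntegrable_exp_neg (l a b : ℝ) :
    IntervalIntegrable (fun w => Real.exp (-(l * w))) volume a b :=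
  Continuous.intervalIntegrable (by fun_prop) _ _

theorem expIntegral_sub (l a b : ℝ) :
    expIntegral l b - expIntegral l a = ∫ w in a..b, Real.exp (-(l * w)) :=
  intervalIntegral.integral_interval_sub_left (intervalIntegrable_exp_neg _ _ _)
    (intervalIntegrable_exp_neg _ _ _)

/-- This is von Neumann's recursion: if `f v` is the probability of an even number of further
successes after the number `v`, then `f v = 1 - l * ∫ f` over `[0, v]`, solved by `f v = exp (-(l *
v))`. -/
theorem mul_expIntegral (l v : ℝ) : l * expIntegral l v = 1 - Real.exp (-(l * v)) := by
  have hd : ∀ w ∈ Set.uIcc 0 v,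
      HasDerivAt (fun w => -Real.exp (-(l * w))) (l * Real.exp (-(l * w))) w := by
    intro w _
    exact (((hasDerivAt_id w).const_mul l).neg.exp.neg).congr_deriv (by simp; ring)
  rw [expIntegral, ← intervalIntegral.integral_const_mul,
    intervalIntegral.integral_eq_sub_of_hasDerivAt hd
      ((intervalIntegrable_exp_neg _ _ _).const_mul l)]
  simp
  ring

theorem continuous_expIntegral : Continuous fun z : ℝ × ℝ => expIntegral z.1 z.2 :=
  intervalIntegral.continuous_parametric_intervalIntegral_of_continuous (by fun_prop)
    continuous_snd

/-- The mean of `exp (-(l * v))` over the numbers `v` whose expansion begins with `s`. -/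
def expMean (l : ℝ) (s : List Bool) : ℝ := dyadicMean (fun v => Real.exp (-(l * v))) s

/-- For `t` in the dyadic interval of `s`, the mean of `exp (-(l * w))`, restricted to `w < t`,
over the numbers `w` whose expansion begins with `s`. -/
def expMeanBelow (l : ℝ) (s : List Bool) (t : ℝ) : ℝ :=
  2 ^ s.length * (expIntegral l t - expIntegral l (dyadic s))

/-- The mean of `exp (-(l * w))`, restricted to `w < v`, over the numbers `w` and `v` whose
expansions begin with `s` and `s'` respectively, where `s'` extends `s`. -/
def compareMean (l : ℝ) (s s' : List Bool) : ℝ := dyadicMean (expMeanBelow l s) s'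

theorem continuous_expMeanBelow (l : ℝ) (s : List Bool) : Continuous (expMeanBelow l s) := by
  have : Continuous fun t => expIntegral l t :=
    continuous_expIntegral.comp (continuous_const.prodMk continuous_id)
  unfold expMeanBelow
  fun_prop

theorem dyadicMean_mem {h : ℝ → ℝ} {s : List Bool} (hc : Continuous h)
    (hm : ∀ t ∈ Set.Icc (0 : ℝ) 1, h (dyadicPoint s t) ∈ Set.Icc (0 : ℝ) 1) :
    dyadicMean h s ∈ Set.Icc (0 : ℝ) 1 := by
  have hi : IntervalIntegrable (fun t => h (dyadicPoint s t)) volume 0 1 :=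
    (hc.comp (continuous_dyadicPoint s)).intervalIntegrable _ _
  refine ⟨intervalIntegral.integral_nonneg zero_le_one fun t ht => (hm t ht).1, ?_⟩
  have := intervalIntegral.integral_mono_on zero_le_one hi
    (intervalIntegrable_const (c := (1 : ℝ))) fun t ht => (hm t ht).2
  simpa [dyadicMean] using this

theorem exp_neg_mul_mem {l w : ℝ} (hl : 0 ≤ l) (hw : 0 ≤ w) :
    Real.exp (-(l * w)) ∈ Set.Icc (0 : ℝ) 1 :=
  ⟨(Real.exp_pos _).le, Real.exp_le_one_iff.2 (neg_nonpos.2 (mul_nonneg hl hw))⟩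

theorem expMean_mem {l : ℝ} (hl : 0 ≤ l) (s : List Bool) :
    expMean l s ∈ Set.Icc (0 : ℝ) 1 :=
  dyadicMean_mem (by fun_prop) fun _ ht => exp_neg_mul_mem hl (dyadicPoint_mem ht).1

theorem dyadic_nonneg (s : List Bool) : 0 ≤ dyadic s := by
  simpa [dyadicPoint] using (dyadicPoint_mem (s := s) (t := 0) (by simp)).1

theorem expMeanBelow_mem {l : ℝ} (hl : 0 ≤ l) (s : List Bool) {t : ℝ}
    (ht : t ∈ Set.Icc (0 : ℝ) 1) :
    expMeanBelow l s (dyadicPoint s t) ∈ Set.Icc (0 : ℝ) 1 := by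
  have hle : dyadic s ≤ dyadicPoint s t := by
    have := ht.1
    unfold dyadicPoint
    have : 0 ≤ (1 / 2 : ℝ) ^ s.length * t := by positivity
    linarith
  have hw : ∀ w ∈ Set.Icc (dyadic s) (dyadicPoint s t),
      Real.exp (-(l * w)) ∈ Set.Icc (0 : ℝ) 1 := fun w hw =>
    exp_neg_mul_mem hl ((dyadic_nonneg s).trans hw.1)
  unfold expMeanBelow
  rw [expIntegral_sub]
  have h0 := intervalIntegral.integral_nonneg (μ := volume) hle fun w h => (hw w h).1
  have h1 := intervalIntegral.integral_mono_on hle (intervalIntegrable_exp_neg l _ _)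
    (intervalIntegrable_const (c := (1 : ℝ))) fun w h => (hw w h).2
  refine ⟨by positivity, ?_⟩
  calc _ ≤ 2 ^ s.length * (dyadicPoint s t - dyadic s) := by
        gcongr
        simpa using h1
    _ = (2 * (1 / 2 : ℝ)) ^ s.length * t := by
        rw [dyadicPoint, mul_pow]
        ring
    _ ≤ 1 := by simpa using ht.2

theorem compareMean_mem {l : ℝ} (hl : 0 ≤ l) (s r : List Bool) :
    compareMean l s (s ++ r) ∈ Set.Icc (0 : ℝ) 1 :=
  dyadicMean_mem (continuous_expMeanBelow l s) fun t ht => by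
    rw [dyadicPoint_append]
    exact expMeanBelow_mem hl s (dyadicPoint_mem ht)

/-- At the right end of the dyadic interval the restriction `w < t` is void. -/
theorem expMean_eq (l : ℝ) (s : List Bool) :
    expMean l s = expMeanBelow l s (dyadicPoint s 1) := by
  have hpos : (2 : ℝ) ^ s.length * (1 / 2) ^ s.length = 1 := by
    rw [← mul_pow]
    norm_num
  have h := intervalIntegral.mul_integral_comp_add_mul (a := 0) (b := 1)
    (f := fun v => Real.exp (-(l * v))) (c := (1 / 2) ^ s.length) (d := dyadic s)
  rw [expMeanBelow, expIntegral_sub, dyadicPoint]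
  simp only [mul_zero, add_zero] at h
  rw [← h, ← mul_assoc, hpos, one_mul]
  rfl

/-- The first digit in which two numbers can differ decides which is less, or they share it. -/
theorem compareMean_cons (l : ℝ) (s : List Bool) (v : Bool) (r : List Bool) :
    compareMean l s (s ++ v :: r) =
      (compareMean l (s ++ [v]) (s ++ v :: r) + if v then expMean l (s ++ [false]) else 0) / 2 := by
  -- For `v = true` the lower half of the interval of `s` lies wholly below `t` and contributes its
  -- full mean; for `v = false` the upper half contributes nothing.
  have hpt : ∀ t, expMeanBelow l s t =
      (expMeanBelow l (s ++ [v]) t + if v then expMean l (s ++ [false]) else 0) / 2 := by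
    intro t
    cases v
    · simp [expMeanBelow, dyadic_append, dyadic_singleton, pow_succ]
      ring
    · rw [expMean_eq]
      have h1 : dyadicPoint (s ++ [false]) 1 = dyadic (s ++ [true]) := by
        simp [dyadicPoint, dyadic_append, dyadic_singleton, pow_succ]
      have h2 : dyadic (s ++ [false]) = dyadic s := by
        simp [dyadic_append, dyadic_singleton]
      simp only [expMeanBelow, h1, h2, List.length_append, List.length_singleton, pow_succ,
        if_true]
      ring
  unfold compareMean dyadicMean
  have hi := (((continuous_expMeanBelow l (s ++ [v])).comp
    (continuous_dyadicPoint (s ++ v :: r))).intervalIntegrable (μ := volume) 0 1)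
  simp only [Function.comp_def] at hi
  simp only [hpt]
  rw [intervalIntegral.integral_div, intervalIntegral.integral_add hi intervalIntegrable_const]
  simp

/-- The recursion `mul_expIntegral`, averaged over the unknown digits of the predecessor. -/
theorem compareMean_nil (l : ℝ) (s : List Bool) : l * compareMean l [] s = 1 - expMean l s := by
  have hi : IntervalIntegrable (fun t => Real.exp (-(l * dyadicPoint s t))) volume 0 1 :=
    Continuous.intervalIntegrable (by have := continuous_dyadicPoint s; fun_prop) _ _
  have h : ∀ t, l * expMeanBelow l [] t = 1 - Real.exp (-(l * t)) := by
    intro t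
    simp [expMeanBelow, dyadic, ← mul_expIntegral, expIntegral]
  unfold compareMean expMean dyadicMean
  rw [← intervalIntegral.integral_const_mul]
  simp only [h]
  rw [intervalIntegral.integral_sub intervalIntegrable_const hi]
  simp

theorem continuous_expMean (s : List Bool) : Continuous fun l => expMean l s := by
  have := continuous_dyadicPoint s
  unfold expMean dyadicMean
  exact intervalIntegral.continuous_parametric_intervalIntegral_of_continuous'
    (by fun_prop) _ _

theorem continuous_compareMean (s s' : List Bool) : Continuous fun l => compareMean l s s' := by
  have h1 := continuous_dyadicPoint s'
  have h2 : Continuous fun z : ℝ × ℝ => expIntegral z.1 (dyadicPoint s' z.2) :=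
    continuous_expIntegral.comp (continuous_fst.prodMk (h1.comp continuous_snd))
  have h3 : Continuous fun z : ℝ × ℝ => expIntegral z.1 (dyadic s) :=
    continuous_expIntegral.comp (continuous_fst.prodMk continuous_const)
  unfold compareMean dyadicMean
  refine intervalIntegral.continuous_parametric_intervalIntegral_of_continuous' ?_ _ _
  exact continuous_const.mul (h2.sub h3)

/-! ### The Gaussian integral -/

/-- The control states of a machine for the Gaussian integral. The first trial, whose stage is
`none`, makes no comparison; otherwise the stage is the parity of the number of successes. -/
inductive GaussState
  | start
  | call (k : Option Bool)
  | recall (k : Option Bool)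
  | query (k : Option Bool)
  | requery (k : Option Bool)
  | toss (k : Option Bool)
  | rewind (p : Bool)
  | read (p : Bool)
  | extend (p : Bool)
  | append (p r : Bool)
  | compare (p r : Bool)
  | advance (p : Bool)
  | erase (p : Bool)
  | lower (p : Bool)
  | halt (b : Bool)
  deriving Fintype

/-- The registers consisting of one string and one bag. -/
abbrev stringAndBag : Registers := ⟨0, 0, 1, 1⟩

/-- A machine that outputs `1` if a first call of the input generator succeeds and an even number
of the trials that follow succeed before the first failure. A trial consists of two calls, two
queries of the bag and a toss of the fair coin, and it draws a uniform number, which must be less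
than its predecessor. Numbers are generated as far as the comparison needs, and the string holds
the digits of the last one that are known. -/
def gaussMachine : Machine stringAndBag where
  State := GaussState
  finite := inferInstance
  start := .start
  code
    | .start => .input fun r => if r then .call none else .halt false
    | .call k => .input fun r => if r then .recall k else .halt (k.getD true)
    | .recall k => .input fun r => if r then .query k else .halt (k.getD true)
    | .query k => .bag (0 : Fin 1) fun r => if r then .requery k else .halt (k.getD true)
    | .requery k => .bag (0 : Fin 1) fun r => if r then .toss k else .halt (k.getD true)
    | .toss k => .flip fun r =>
        if r then k.elim (.call (some false)) .rewind else .halt (k.getD true)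
    | .rewind p => .rewind (0 : Fin 1) (.read p)
    | .read p => .read (0 : Fin 1) fun r => r.elim (.extend p) (.compare p)
    | .extend p => .flip (.append p)
    | .append p r => .write (0 : Fin 1) r (.compare p r)
    -- `d` is the new number's digit, `r` its predecessor's. If `d < r`, the known digits of the new
    -- number are those before the cursor followed by `0`; if `d > r`, the trial fails.
    | .compare p r => .flip fun d =>
        if d = r then .advance p else if r then .erase p else .halt p
    | .advance p => .advance (0 : Fin 1) (.read p)
    | .erase p => .erase (0 : Fin 1) (.lower p)
    | .lower p => .write (0 : Fin 1) false (.call (some !p))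
    | .halt b => .halt b

/-- The comparison loop contains no call of the input. Equal digits lead from rank `13` up to `17`,
the permitted rise of `4`; unequal digits halt or lead to rank `2`, a drop of `11`. -/
theorem gaussMachine_ranked : gaussMachine.Ranked
    (fun | .start => some 0 | .call _ => some 0 | .recall _ => some 0 | .query _ => some 24
         | .requery _ => some 21 | .toss _ => some 18 | .rewind _ => some 17 | .read _ => some 16
         | .extend _ => some 15 | .append _ _ => some 14 | .compare _ _ => some 13
         | .advance _ => some 17 | .erase _ => some 2 | .lower _ => some 1 | .halt _ => none)
    24 := by
  rintro (_ | k | k | k | k | k | p | p | p | ⟨p, r⟩ | ⟨p, r⟩ | p | p | p | b)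
  case toss =>
    refine ⟨by norm_num, Or.inl ?_⟩
    rintro (_ | _)
    · simp [DropsBy]
    · cases k <;> simp [DropsBy]
  case read =>
    refine ⟨by norm_num, ?_⟩
    rintro (_ | _) <;> simp [DropsBy]
  case compare =>
    refine ⟨by norm_num, Or.inr ⟨r, ?_⟩⟩
    cases r <;> simp [DropsBy]
  all_goals simp [gaussMachine, DropsBy]

/-- The number `a`, or its complement. -/
def orient (p : Bool) (a : ℝ) : ℝ := if p then a else 1 - a

theorem orient_mem (p : Bool) {a : ℝ} (ha : a ∈ Set.Icc (0 : ℝ) 1) :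
    orient p a ∈ Set.Icc (0 : ℝ) 1 := by
  cases p
  · exact ⟨sub_nonneg.2 ha.2, sub_le_self _ ha.1⟩
  · exact ha

theorem orient_not (p : Bool) (a : ℝ) : orient (!p) a = orient p (1 - a) := by
  cases p <;> simp [orient]

theorem continuousOn_orient (p : Bool) {f : ℝ → ℝ} {s : Set ℝ} (hf : ContinuousOn f s) :
    ContinuousOn (fun u => orient p (f u)) s := by
  cases p
  · exact continuousOn_const.sub hf
  · exact hf

theorem orient_mix (p : Bool) (t a : ℝ) :
    orient p (1 - t * a) = t * orient p (1 - a) + (1 - t) * digit p := by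
  cases p
  · simp [orient]
  · simp [orient]
    ring

/-- The word in a string register. -/
def StringReg.word (τ : StringReg) : List Bool := τ.left ++ τ.right

/-- The rate of the exponential whose alternating series the Gaussian machine sums. -/
def gaussRate (x u : ℝ) : ℝ := x * (x * (u * (u * (1 / 2))))

/-- The probability that the comparison of a trial succeeds, and the number of successes of the
following trials is even. -/
def gaussPass (l : ℝ) (τ : StringReg) : Option Bool → ℝ
  | none => expMean l τ.word
  | some _ => compareMean l [] τ.word

/-- The value of the Gaussian machine. -/
def gaussValue (x : ℝ) (τ : StringReg) : GaussState → ℝ → ℝ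
  | .start, u => x * (1 - gaussRate x u * expMean (gaussRate x u) τ.word) + (1 - x) * 0
  | .call k, u => orient (k.getD true)
      (1 - x * (x * (u * (u * (1 / 2 * gaussPass (gaussRate x u) τ k)))))
  | .recall k, u => orient (k.getD true)
      (1 - x * (u * (u * (1 / 2 * gaussPass (gaussRate x u) τ k))))
  | .query k, u => orient (k.getD true) (1 - u * (u * (1 / 2 * gaussPass (gaussRate x u) τ k)))
  | .requery k, u => orient (k.getD true) (1 - u * (1 / 2 * gaussPass (gaussRate x u) τ k))
  | .toss k, u => orient (k.getD true) (1 - 1 / 2 * gaussPass (gaussRate x u) τ k)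
  | .rewind p, u => orient p (1 - compareMean (gaussRate x u) [] τ.word)
  | .read p, u => orient p (1 - compareMean (gaussRate x u) τ.left τ.word)
  | .extend p, u =>
      (orient p (1 - compareMean (gaussRate x u) τ.left (τ.left ++ true :: τ.right.tail)) +
        orient p (1 - compareMean (gaussRate x u) τ.left (τ.left ++ false :: τ.right.tail))) / 2
  | .append p r, u =>
      orient p (1 - compareMean (gaussRate x u) τ.left (τ.left ++ r :: τ.right.tail))
  | .compare p r, u =>
      (orient p (1 - compareMean (gaussRate x u) τ.advance.left τ.advance.word) +
        if r then orient p (1 - expMean (gaussRate x u) (τ.left ++ [false])) else digit p) / 2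
  | .advance p, u => orient p (1 - compareMean (gaussRate x u) τ.advance.left τ.advance.word)
  | .erase p, u => orient p (1 - expMean (gaussRate x u) (τ.left ++ [false]))
  | .lower p, u => orient p (1 - expMean (gaussRate x u) (τ.left ++ false :: τ.right.tail))
  | .halt b, _ => digit b

/-- `compareMean_cons` is the one-step equation of the digit comparison. -/
theorem gaussValue_compare (x u : ℝ) (L T : List Bool) (p r : Bool) :
    gaussValue x ⟨L, r :: T⟩ (.compare p r) u =
      orient p (1 - compareMean (gaussRate x u) L (L ++ r :: T)) := by
  rw [compareMean_cons]
  cases p <;> cases r <;>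
    simp [gaussValue, StringReg.advance, StringReg.word, orient] <;> ring

/-- By `compareMean_nil`, the value before a trial is the mean of `exp (-(l * v))` over the numbers
`v` that begin with the known digits. -/
theorem gaussValue_call_some (x u : ℝ) (τ : StringReg) (p : Bool) :
    gaussValue x τ (.call (some p)) u = orient p (expMean (gaussRate x u) τ.word) := by
  have h := compareMean_nil (gaussRate x u) τ.word
  have h' : x * (x * (u * (u * (1 / 2 * compareMean (gaussRate x u) [] τ.word)))) =
      1 - expMean (gaussRate x u) τ.word := by
    rw [← h]
    simp only [gaussRate]
    ring
  simp only [gaussValue, gaussPass, h', Option.getD_some, sub_sub_cancel]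

theorem unit_mul_mem {a b : ℝ} (ha : a ∈ Set.Icc (0 : ℝ) 1) (hb : b ∈ Set.Icc (0 : ℝ) 1) :
    a * b ∈ Set.Icc (0 : ℝ) 1 :=
  ⟨mul_nonneg ha.1 hb.1, mul_le_one₀ ha.2 hb.1 hb.2⟩

theorem one_sub_mem {a : ℝ} (ha : a ∈ Set.Icc (0 : ℝ) 1) : 1 - a ∈ Set.Icc (0 : ℝ) 1 :=
  ⟨sub_nonneg.2 ha.2, sub_le_self _ ha.1⟩

theorem mean_mem {a b : ℝ} (ha : a ∈ Set.Icc (0 : ℝ) 1) (hb : b ∈ Set.Icc (0 : ℝ) 1) :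
    (a + b) / 2 ∈ Set.Icc (0 : ℝ) 1 :=
  ⟨by linarith [ha.1, hb.1], by linarith [ha.2, hb.2]⟩

theorem gaussValue_mem {x u : ℝ} (hx : x ∈ Set.Icc (0 : ℝ) 1) (hu : u ∈ Set.Icc (0 : ℝ) 1)
    (τ : StringReg) (s : GaussState) : gaussValue x τ s u ∈ Set.Icc (0 : ℝ) 1 := by
  have hhalf : (1 / 2 : ℝ) ∈ Set.Icc (0 : ℝ) 1 := by norm_num
  have hl : gaussRate x u ∈ Set.Icc (0 : ℝ) 1 :=
    unit_mul_mem hx (unit_mul_mem hx (unit_mul_mem hu (unit_mul_mem hu hhalf)))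
  have hE := expMean_mem hl.1
  have hC := compareMean_mem hl.1
  have hP : ∀ k, gaussPass (gaussRate x u) τ k ∈ Set.Icc (0 : ℝ) 1 := by
    rintro (_ | p)
    · exact hE _
    · exact hC [] τ.word
  have hP2 := fun k => unit_mul_mem hhalf (hP k)
  have hP3 := fun k => unit_mul_mem hu (hP2 k)
  have hP4 := fun k => unit_mul_mem hu (hP3 k)
  have hP5 := fun k => unit_mul_mem hx (hP4 k)
  rcases s with _ | k | k | k | k | k | p | p | p | ⟨p, r⟩ | ⟨p, r⟩ | p | p | p | b
  · exact mix_mem hx (one_sub_mem (unit_mul_mem hl (hE _))) (by simp)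
  · exact orient_mem _ (one_sub_mem (unit_mul_mem hx (hP5 k)))
  · exact orient_mem _ (one_sub_mem (hP5 k))
  · exact orient_mem _ (one_sub_mem (hP4 k))
  · exact orient_mem _ (one_sub_mem (hP3 k))
  · exact orient_mem _ (one_sub_mem (hP2 k))
  · exact orient_mem _ (one_sub_mem (hC [] τ.word))
  · exact orient_mem _ (one_sub_mem (hC _ _))
  · exact mean_mem (orient_mem _ (one_sub_mem (hC _ _))) (orient_mem _ (one_sub_mem (hC _ _)))
  · exact orient_mem _ (one_sub_mem (hC _ _))
  · refine mean_mem (orient_mem _ (one_sub_mem (hC _ _))) ?_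
    split_ifs
    · exact orient_mem _ (one_sub_mem (hE _))
    · exact digit_mem _
  · exact orient_mem _ (one_sub_mem (hC _ _))
  · exact orient_mem _ (one_sub_mem (hE _))
  · exact orient_mem _ (one_sub_mem (hE _))
  · exact digit_mem _

theorem continuousOn_gaussValue (x : ℝ) (τ : StringReg) (s : GaussState) :
    ContinuousOn (gaussValue x τ s) (Set.Icc 0 1) := by
  have hl : Continuous (gaussRate x) := by
    unfold gaussRate
    fun_prop
  have hE := fun w => ((continuous_expMean w).comp hl).continuousOn (s := Set.Icc 0 1)
  have hC := fun w w' => ((continuous_compareMean w w').comp hl).continuousOn (s := Set.Icc 0 1)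
  have hP : ∀ k, ContinuousOn (fun u => gaussPass (gaussRate x u) τ k) (Set.Icc 0 1) := by
    rintro (_ | p)
    · exact hE _
    · exact hC _ _
  have hEo := fun p w => continuousOn_orient p ((continuousOn_const (c := (1 : ℝ))).sub (hE w))
  have hCo := fun p w w' =>
    continuousOn_orient p ((continuousOn_const (c := (1 : ℝ))).sub (hC w w'))
  rcases s with _ | k | k | k | k | k | p | p | p | ⟨p, r⟩ | ⟨p, r⟩ | p | p | p | b
  · exact (continuousOn_const.mul
      (continuousOn_const.sub (hl.continuousOn.mul (hE _)))).add continuousOn_const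
  iterate 5
    have := hP k
    exact continuousOn_orient _ (by fun_prop)
  · exact hCo _ _ _
  · exact hCo _ _ _
  · exact ((hCo _ _ _).add (hCo _ _ _)).div_const 2
  · exact hCo _ _ _
  · refine ((hCo _ _ _).add ?_).div_const 2
    cases r
    · exact continuousOn_const
    · exact hEo _ _
  · exact hCo _ _ _
  · exact hEo _ _
  · exact hEo _ _
  · exact continuousOn_const

theorem gaussMachine_isValue {x : ℝ} (hx0 : 0 ≤ x) (hx1 : x ≤ 1) :
    gaussMachine.IsValue (0 : Fin 1) x fun s _ τ u => gaussValue x (τ (0 : Fin 1)) s u where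
  mem s _ τ u hu := gaussValue_mem ⟨hx0, hx1⟩ hu _ s
  cont s _ τ := continuousOn_gaussValue x _ s
  step := by
    rintro (_ | k | k | k | k | k | p | p | p | ⟨p, r⟩ | ⟨p, r⟩ | p | p | p | b) σ τ u hu
    · simp [gaussMachine, gaussValue, gaussPass, gaussRate, orient, mul_assoc]
    · exact orient_mix _ _ _
    · exact orient_mix _ _ _
    · exact ⟨rfl, orient_mix _ _ _⟩
    · exact ⟨rfl, orient_mix _ _ _⟩
    · simp only [gaussMachine, if_true, Bool.false_eq_true, if_false]
      rcases k with _ | p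
      · rw [Option.elim_none, gaussValue_call_some]
        simp [gaussValue, gaussPass, orient]
        ring
      · simp only [Option.elim_some, gaussValue, gaussPass, Option.getD_some]
        rw [orient_mix]
        ring
    · simp [gaussMachine, gaussValue, StringReg.rewind, StringReg.word]
    · simp only [gaussMachine]
      rcases hτ : τ (0 : Fin 1) with ⟨L, _ | ⟨r, T⟩⟩
      · simp only [StringReg.read, List.head?_nil, Option.elim_none]
        -- The known digits are exhausted: the predecessor gets a new fair digit, which splits the
        -- mean in two.
        have h := dyadicMean_eq (continuous_expMeanBelow (gaussRate x u) L).continuousOn L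
        cases p <;> simp [gaussValue, StringReg.word, orient, compareMean, h]
        ring
      · simp only [StringReg.read, List.head?_cons, Option.elim_some, gaussValue_compare]
        rfl
    · rfl
    · simp only [gaussMachine, Function.update_self, StringReg.write, gaussValue_compare]
      rfl
    · cases r
      · simp [gaussMachine, gaussValue, add_comm]
      · simp [gaussMachine, gaussValue]
    · simp [gaussMachine, gaussValue]
    · simp [gaussMachine, gaussValue, StringReg.erase]
    · simp only [gaussMachine, Function.update_self, gaussValue_call_some, orient_not]
      rfl
    · rfl

theorem integral_gaussValue (x : ℝ) :
    ∫ u in (0 : ℝ)..1, gaussValue x ⟨[], []⟩ .start u =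
      ∫ w in (0 : ℝ)..x, Real.exp (-w ^ 2 / 2) := by
  -- The string is empty and the first trial makes no comparison, so it acts as if the predecessor
  -- were `1` and yields `exp (-l)`.
  have h : ∀ u, gaussValue x ⟨[], []⟩ .start u = x * Real.exp (-(x * u) ^ 2 / 2) := by
    intro u
    have hmean : expMean (gaussRate x u) [] = expIntegral (gaussRate x u) 1 := by
      simp [expMean, dyadicMean, dyadicPoint_nil, expIntegral]
    simp only [gaussValue, StringReg.word, List.append_nil, hmean, mul_expIntegral, mul_one,
      mul_zero, add_zero, sub_sub_cancel]
    congr 2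
    simp only [gaussRate]
    ring
  simp only [h]
  rw [intervalIntegral.integral_const_mul,
    intervalIntegral.mul_integral_comp_mul_left (f := fun w => Real.exp (-w ^ 2 / 2))]
  simp

theorem stronglyRealizable_gauss :
    StronglyRealizable stringAndBag fun x => ∫ w in (0 : ℝ)..x, Real.exp (-w ^ 2 / 2) :=
  stronglyRealizable_of_isValue gaussMachine (0 : Fin 1) fun x hx =>
    ⟨gaussMachine_ranked.exists_lyapunov hx, _,
      gaussMachine_isValue x.coe_nonneg (by exact_mod_cast hx.le), integral_gaussValue x⟩

end Buffon

end

theorem theorem7 :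
    Buffon.StronglyRealizable { numCounters := 0, numStacks := 0, numStrings := 0, numBags := 1 }
      (fun x => Real.log (1 + x)) ∧
    Buffon.StronglyRealizable { numCounters := 0, numStacks := 0, numStrings := 0, numBags := 1 }
      (fun x => Real.arctan x) ∧
    Buffon.StronglyRealizable { numCounters := 0, numStacks := 1, numStrings := 0, numBags := 1 }
      (fun x => 1 / 2 * Real.arcsin x) ∧
    Buffon.StronglyRealizable { numCounters := 0, numStacks := 0, numStrings := 1, numBags := 1 }
      (fun x => ∫ w in (0 : ℝ)..x, Real.exp (-w ^ 2 / 2)) :=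
  ⟨Buffon.stronglyRealizable_log, Buffon.stronglyRealizable_arctan,
    Buffon.stronglyRealizable_half_arcsin, Buffon.stronglyRealizable_gauss⟩
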